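/- **Definitions.** Let $\mathcal M\subseteq\mathcal B(\mathcal H)$ be a von Neumann algebra. A *quantum metric* on $\mathcal M$ is a family $\mathbb V=(\mathcal V_t)_{t\ge 0}$ of weak*-closed self-adjoint subspaces of $\mathcal B(\mathcal H)$ with $\mathcal V_0=\mathcal M'$, $\mathcal V_s\mathcal V_t\subseteq\mathcal V_{s+t}$ and $\mathcal V_t=\bigcap_{s>t}\mathcal V_s$; it is *reflexive* if each $\mathcal V_t$ equals $\{B\in\mathcal B(\mathcal H): PBQ=0$ for all projections $P,Q\in\mathcal B(\mathcal H)$ with $P\mathcal V_tQ=\{0\}\}$. For projections $P,Q$ in $\mathcal M\overline\otimes\mathcal B(\ell_2)$ put $\operatorname{dist}(P,Q)=\inf\{t: P(A\otimes \mathrm{id})Q\ne0\text{ for some }A\in\mathcal V_t\}\in[0,\infty]$, and regard $\mathcal M$ as $\mathcal M\otimes\mathrm{id}$. For a projection $P\in\mathcal M$ let $$\operatorname{diam}(P)=\sup\{\operatorname{dist}(Q,R): Q,R\in\mathcal M\overline\otimes\mathcal B(\ell_2)\text{ projections},\ Q(PAP\otimes \mathrm{id})R\neq0\text{ for some }A\in\mathcal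 B(\mathcal H)\}$$ (so $\operatorname{diam}(0)=0$), and $(P)_r=\mathrm{id}-\bigvee\{Q\in\mathcal M\text{ a projection}:\operatorname{dist}(P,Q)\ge r\}$. We say $\operatorname{asdim}(\mathcal M)\le n$ if for every $r>0$ there are sets $\mathscr P^0,\dots,\mathscr P^n$ of projections in $\mathcal M$ such that in each $\mathscr P^i$ the diameters are bounded by a finite constant and $(P)_r(Q)_r=0$ for distinct $P,Q\in\mathscr P^i$, and such that $\bigvee\bigcup_i\mathscr P^i=\mathrm{id}$; $\operatorname{asdim}(\mathcal M)=\infty$ means that this holds for no $n\in\mathbb N\cup\{0\}$. A *quantum function* $\phi:\mathcal M\to\mathcal N$ is a unital weak*-continuous $*$-homomorphism. For quantum metric spaces $\mathcal M,\mathcal N$ let $\tilde\omega_\phi(t)=\inf\{\operatorname{dist}(\phi(P),\phi(Q)):\operatorname{dist}(P,Q)\ge t\}$ and $\tilde\rho_\phi(t)=\sup\{\operatorname{diam}(\phi(P)):\operatorname{diam}(P)\le t\}$, where $P,Q$ range over the projections in $\mathcal M$; $\phi$ is a *quantum coarse embedding* if $\tilde\omega_\phi(t)\to\infty$ as $t\to\infty$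 and $\tilde\rho_\phi(t)<\infty$ for all $t\ge0$. We say $\mathcal M$ *equi-coarsely contains* $(\mathcal N_m)_m$ if there are quantum coarse embeddings $\phi_m:\mathcal M\to\mathcal N_m$ and functions $f,g$ on $[0,\infty)$, independent of $m$, with $f(t)\to\infty$, $g(t)<\infty$, $f(t)\le\tilde\omega_{\phi_m}(t)$ and $\tilde\rho_{\phi_m}(t)\le g(t)$ for all $t$ and $m$. A *metric quotient* of $(\mathcal M,\mathbb V)$ is a quantum metric space isometrically isomorphic to $(R\mathcal M\subseteq\mathcal B(R\mathcal H),(R\mathcal V_tR)_{t\ge0})$ for a central projection $R$ of $\mathcal M$; an *isometric isomorphism* is a weak*-continuous $*$-isomorphism $\psi$ such that $\psi\otimes\mathrm{id}$ preserves distances between projections in the tensor product with $\mathcal B(\ell_2)$. Let $\varepsilon\in(0,1)$ and $d\in\mathbb N$. A completely positive trace-preserving map $\Phi:M_n\to M_n$ is a *$d$-regular $\varepsilon$-quantum expander* if $\Phi(X)=\frac1d\sum_{j=1}^dU_jXU_j^*$ for some unitaries $U_1,\dots,U_d\in M_n$ and $\|\Phi(X)-\frac1n\operatorname{tr}(X)I_n\|_{HS}\le(1-\varepsilon)\|X-\frac1n\operatorname{tr}(X)I_n\|_{HS}$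 for all $X\in M_n$. If $\Phi(X)=\sum_jK_jXK_j^*$, then $M_n=\mathcal B(\mathbb C^n)$ carries the quantum metric $\mathcal V_t=\mathcal S^{\lfloor t\rfloor}$, where $\mathcal S=\operatorname{span}\{K_j^*K_i\}_{i,j}$ and $\mathcal S^0=\mathbb C I_n$. A *sequence of reflexive $d$-regular $\varepsilon$-quantum expanders* consists of $d$-regular $\varepsilon$-quantum expanders $\Phi_m:M_{n_m}\to M_{n_m}$ with $n_m\to\infty$ whose associated quantum metrics are reflexive. A finite graph $G$ with vertex set $X$ is a *$d$-regular $\varepsilon$-classical expander* ($\varepsilon>0$) if every vertex has exactly $d$ neighbours and every $S\subseteq X$ with $|S|\le|X|/2$ has at least $\varepsilon|S|$ edges joining it to $X\setminus S$. It induces the quantum metric $\mathcal V_t=\{A\in\mathcal B(\ell_2(X)):\langle Ae_x,e_y\rangle=0\text{ whenever }d_G(x,y)>t\}$ on $\ell_\infty(X)\subseteq\mathcal B(\ell_2(X))$, where $d_G$ is the path distance. **Theorem.** Let $\mathcal M$ be a quantum metric space. 1. If $\mathcal M$ equi-coarsely contains a sequence $(M_{n_m})_m$ of reflexive $d$-regular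 $\varepsilon$-quantum expanders, for some $d\in\mathbb N$ and $\varepsilon\in(0,1)$, then $\operatorname{asdim}(\mathcal M)=\infty$. 2. In particular, $\operatorname{asdim}(\mathcal M)=\infty$ whenever there is a sequence of reflexive $d$-regular $\varepsilon$-quantum expanders each of which is a metric quotient of $\mathcal M$. 3. If $\mathcal M$ equi-coarsely contains a sequence $(\ell_\infty(X_m))_m$ given by $d$-regular $\varepsilon$-classical expanders $G_m$ on finite sets $X_m$ with $|X_m|\to\infty$, for some $d\in\mathbb N$ and $\varepsilon>0$, then $\operatorname{asdim}(\mathcal M)=\infty$. -/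

import Mathlib

open Filter Topology
open scoped ENNReal NNReal Matrix InnerProductSpace

set_option linter.unusedSectionVars false
set_option linter.style.haveILetI false

noncomputable section

namespace QuantumCoarse

/-! ### Amplification and the weak-star topology -/

section Amplification

variable {H : Type*} [NormedAddCommGroup H] [InnerProductSpace ℂ H]

/-- The Hilbert space `H ⊗ ℓ²`, realised as `ℓ²(ℕ; H)`. -/
abbrev Stab (H : Type*) [NormedAddCommGroup H] : Type _ := lp (fun _ : ℕ => H) 2

/-- The operator `A ⊗ id` on `H ⊗ ℓ²`: it applies `A` in every coordinate. -/
def ampl (A : H →L[ℂ] H) : Stab H →L[ℂ] Stab H :=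
  lp.mapCLM 2 (fun _ : ℕ => A) (norm_nonneg A) (fun _ => le_rfl)

theorem ampl_apply (A : H →L[ℂ] H) (x : Stab H) (i : ℕ) : ampl A x i = A (x i) := rfl

/-- The `(i, j)` entry, in `B(H)`, of an operator on `H ⊗ ℓ²` seen as an infinite matrix. -/
def entry (T : Stab H →L[ℂ] Stab H) (i j : ℕ) : H →L[ℂ] H :=
  (lp.evalCLM ℂ (fun _ : ℕ => H) 2 i) ∘L T ∘L
    (lp.singleContinuousLinearMap ℂ (fun _ : ℕ => H) 2 j)

/-- The weak-star (ultraweak) topology of `B(H)`, as the dual of the trace class operators: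
the coarsest topology for which all the functionals
`A ↦ ⟪x, (A ⊗ id) y⟫ = ∑ i, ⟪x i, A (y i)⟫`, with `x, y ∈ ℓ²(ℕ; H)`, are continuous. -/
abbrev weakStar (H : Type*) [NormedAddCommGroup H] [InnerProductSpace ℂ H] :
    TopologicalSpace (H →L[ℂ] H) :=
  ⨅ (x : Stab H) (y : Stab H),
    TopologicalSpace.induced (fun A : H →L[ℂ] H => ⟪x, ampl A y⟫_ℂ) inferInstance

theorem continuous_weakStar_inner_ampl (x y : Stab H) :
    @Continuous _ _ (weakStar H) _ (fun A : H →L[ℂ] H => ⟪x, ampl A y⟫_ℂ) := by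
  rw [continuous_iff_le_induced]
  exact (iInf_le _ x).trans (iInf_le _ y)

theorem continuous_weakStar_inner (x y : H) :
    @Continuous _ _ (weakStar H) _ (fun A : H →L[ℂ] H => ⟪x, A y⟫_ℂ) := by
  have h := continuous_weakStar_inner_ampl (lp.single 2 0 x : Stab H) (lp.single 2 0 y)
  convert h using 2 with A
  rw [lp.inner_single_left, ampl_apply, lp.single_apply_self]

theorem continuous_weakStar_rng {X : Type*} [TopologicalSpace X] (f : X → (H →L[ℂ] H))
    (hf : ∀ x y : Stab H, Continuous fun a => ⟪x, ampl (f a) y⟫_ℂ) :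
    @Continuous X _ _ (weakStar H) f := by
  refine continuous_iInf_rng.2 fun x => continuous_iInf_rng.2 fun y => ?_
  exact continuous_induced_rng.2 (hf x y)

end Amplification

/-! ### Quantum metrics -/

section Metric

variable {H : Type*} [NormedAddCommGroup H] [InnerProductSpace ℂ H] [CompleteSpace H]

/-- A quantum metric on a von Neumann algebra `M ⊆ B(H)`. -/
structure QuantumMetric (M : VonNeumannAlgebra H) where
  /-- The operators of displacement at most `t`. -/
  V : ℝ≥0 → Submodule ℂ (H →L[ℂ] H)
  weakStar_closed : ∀ t, IsClosed[weakStar H] (V t : Set (H →L[ℂ] H))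
  zero_eq : (V 0 : Set (H →L[ℂ] H)) = (M.commutant : Set (H →L[ℂ] H))
  star_mem : ∀ t, ∀ A ∈ V t, star A ∈ V t
  mul_mem : ∀ s t, ∀ A ∈ V s, ∀ B ∈ V t, A * B ∈ V (s + t)
  eq_iInf : ∀ t, V t = ⨅ s : Set.Ioi t, V s

/-- `P` is an (orthogonal) projection belonging to `M`. -/
def IsProj (M : VonNeumannAlgebra H) (P : H →L[ℂ] H) : Prop :=
  IsStarProjection P ∧ P ∈ M

/-- `P` is a projection belonging to the normal spatial tensor product of `M` and `B(ℓ²)`, that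
is, a projection on `H ⊗ ℓ²` all of whose matrix entries belong to `M`. -/
def IsStabProj (M : VonNeumannAlgebra H) (P : Stab H →L[ℂ] Stab H) : Prop :=
  IsStarProjection P ∧ ∀ i j, entry P i j ∈ M

/-- The join of a set of projections: the projection onto the closed span of their ranges. -/
def projSup (S : Set (H →L[ℂ] H)) : H →L[ℂ] H :=
  (⨆ P ∈ S, P.range).topologicalClosure.starProjection

namespace QuantumMetric

variable {M : VonNeumannAlgebra H} (𝓥 : QuantumMetric M)

/-- The distance between two projections in `M`, with values in `[0, ∞]`. -/
def dist (P Q : H →L[ℂ] H) : ℝ≥0∞ :=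
  ⨅ (t : ℝ≥0) (_ : ∃ A ∈ 𝓥.V t, P * A * Q ≠ 0), (t : ℝ≥0∞)

/-- The distance between two projections in the tensor product of `M` and `B(ℓ²)`. -/
def stabDist (P Q : Stab H →L[ℂ] Stab H) : ℝ≥0∞ :=
  ⨅ (t : ℝ≥0) (_ : ∃ A ∈ 𝓥.V t, P * ampl A * Q ≠ 0), (t : ℝ≥0∞)

/-- The diameter of a projection in `M` (it is `0` for the zero projection, as the supremum of
the empty set). -/
def diam (P : H →L[ℂ] H) : ℝ≥0∞ :=
  ⨆ (Q : Stab H →L[ℂ] Stab H) (R : Stab H →L[ℂ] Stab H)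
    (_ : IsStabProj M Q ∧ IsStabProj M R ∧ ∃ A : H →L[ℂ] H, Q * ampl (P * A * P) * R ≠ 0),
    𝓥.stabDist Q R

/-- The open `r`-neighbourhood of a projection in `M`. -/
def nhd (r : ℝ≥0) (P : H →L[ℂ] H) : H →L[ℂ] H :=
  1 - projSup {Q | IsProj M Q ∧ (r : ℝ≥0∞) ≤ 𝓥.dist P Q}

/-- Operator reflexivity of a quantum metric: every `V t` is a reflexive subspace of `B(H)`. -/
def IsReflexive : Prop :=
  ∀ t, (𝓥.V t : Set (H →L[ℂ] H)) =
    {B | ∀ P Q : H →L[ℂ] H, IsStarProjection P → IsStarProjection Q →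
      (∀ A ∈ 𝓥.V t, P * A * Q = 0) → P * B * Q = 0}

/-- A set of projections covers `M` if its join is the identity. -/
def IsCover (S : Set (H →L[ℂ] H)) : Prop := projSup S = 1

/-- `r`-disjointness of a family of projections. -/
def IsDisjointFamily (r : ℝ≥0) (S : Set (H →L[ℂ] H)) : Prop :=
  ∀ P ∈ S, ∀ Q ∈ S, P ≠ Q → 𝓥.nhd r P * 𝓥.nhd r Q = 0

/-- Uniform boundedness of a family of projections. -/
def IsUniformlyBounded (S : Set (H →L[ℂ] H)) : Prop :=
  ∃ R : ℝ≥0, ∀ P ∈ S, 𝓥.diam P ≤ R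

/-- The asymptotic dimension is at most `n`. -/
def AsdimLE (n : ℕ) : Prop :=
  ∀ r : ℝ≥0, 0 < r → ∃ 𝓕 : Fin (n + 1) → Set (H →L[ℂ] H),
    (∀ i, (∀ P ∈ 𝓕 i, IsProj M P) ∧ 𝓥.IsUniformlyBounded (𝓕 i) ∧ 𝓥.IsDisjointFamily r (𝓕 i)) ∧
    IsCover (⋃ i, 𝓕 i)

/-- The asymptotic dimension, with values in `ℕ ∪ {∞}`. -/
def asdim : ℕ∞ := ⨅ (n : ℕ) (_ : 𝓥.AsdimLE n), (n : ℕ∞)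

end QuantumMetric

end Metric

/-! ### Quantum functions, coarse embeddings, isometric isomorphisms -/

section Functions

variable {H : Type*} [NormedAddCommGroup H] [InnerProductSpace ℂ H] [CompleteSpace H]
  {K : Type*} [NormedAddCommGroup K] [InnerProductSpace ℂ K] [CompleteSpace K]

/-- A quantum function: a unital weak-star continuous `*`-homomorphism between von Neumann
algebras (with their relative weak-star topologies). -/
structure QuantumFunction (M : VonNeumannAlgebra H) (N : VonNeumannAlgebra K) where
  /-- The underlying unital `*`-homomorphism. -/
  toHom : M.toStarSubalgebra →⋆ₐ[ℂ] N.toStarSubalgebra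
  weakStar_continuous :
    @Continuous _ _ (TopologicalSpace.induced Subtype.val (weakStar H))
      (TopologicalSpace.induced Subtype.val (weakStar K)) toHom

namespace QuantumFunction

variable {M : VonNeumannAlgebra H} {N : VonNeumannAlgebra K}

/-- The modulus `ω̃ t = inf {dist (φ P) (φ Q) | dist P Q ≥ t}`, over projections of `M`. -/
def omega (φ : QuantumFunction M N) (𝓥 : QuantumMetric M) (𝓦 : QuantumMetric N) (t : ℝ≥0) :
    ℝ≥0∞ :=
  ⨅ (P : M.toStarSubalgebra) (Q : M.toStarSubalgebra)
    (_ : IsStarProjection (P : H →L[ℂ] H) ∧ IsStarProjection (Q : H →L[ℂ] H) ∧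
      (t : ℝ≥0∞) ≤ 𝓥.dist P Q),
    𝓦.dist (φ.toHom P : K →L[ℂ] K) (φ.toHom Q : K →L[ℂ] K)

/-- The modulus `ρ̃ t = sup {diam (φ P) | diam P ≤ t}`, over projections of `M`. -/
def rho (φ : QuantumFunction M N) (𝓥 : QuantumMetric M) (𝓦 : QuantumMetric N) (t : ℝ≥0) :
    ℝ≥0∞ :=
  ⨆ (P : M.toStarSubalgebra)
    (_ : IsStarProjection (P : H →L[ℂ] H) ∧ 𝓥.diam (P : H →L[ℂ] H) ≤ t),
    𝓦.diam (φ.toHom P : K →L[ℂ] K)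

/-- Quantum coarse embeddings. -/
def IsCoarseEmbedding (φ : QuantumFunction M N) (𝓥 : QuantumMetric M) (𝓦 : QuantumMetric N) :
    Prop :=
  Tendsto (φ.omega 𝓥 𝓦) atTop (𝓝 ∞) ∧ ∀ t, φ.rho 𝓥 𝓦 t < ∞

/-- `(φ ⊗ id) P = P'`, for `P` in the tensor product of `M` and `B(ℓ²)` and `P'` in that of `N`
and `B(ℓ²)`: the matrix of `P'` is obtained by applying `φ` to the entries of that of `P`. -/
def StabMapsTo (φ : QuantumFunction M N) (P : Stab H →L[ℂ] Stab H)
    (P' : Stab K →L[ℂ] Stab K) : Prop :=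
  ∀ i j, ∃ h : entry P i j ∈ M.toStarSubalgebra,
    (φ.toHom ⟨entry P i j, h⟩ : K →L[ℂ] K) = entry P' i j

/-- Isometric isomorphisms of quantum metric spaces: `φ` is bijective and `φ ⊗ id` preserves the
distance between projections of the tensor product with `B(ℓ²)`. -/
def IsIsometricIso (φ : QuantumFunction M N) (𝓥 : QuantumMetric M) (𝓦 : QuantumMetric N) :
    Prop :=
  Function.Bijective φ.toHom ∧
  ∀ P Q P' Q', IsStabProj M P → IsStabProj M Q → IsStabProj N P' → IsStabProj N Q' →
    φ.StabMapsTo P P' → φ.StabMapsTo Q Q' → 𝓦.stabDist P' Q' = 𝓥.stabDist P Q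

end QuantumFunction

/-- `M` equi-coarsely contains the family `N i`: there is an equi-coarse family of quantum coarse
embeddings `φ i : M → N i`. -/
def EquiCoarselyContains {M : VonNeumannAlgebra H} (𝓥 : QuantumMetric M)
    {ι : Type*} {L : ι → Type*} [∀ i, NormedAddCommGroup (L i)]
    [∀ i, InnerProductSpace ℂ (L i)] [∀ i, CompleteSpace (L i)]
    {N : ∀ i, VonNeumannAlgebra (L i)} (𝓦 : ∀ i, QuantumMetric (N i)) : Prop :=
  ∃ φ : ∀ i, QuantumFunction M (N i),
    (∀ i, (φ i).IsCoarseEmbedding 𝓥 (𝓦 i)) ∧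
    ∃ f g : ℝ≥0 → ℝ≥0∞, Tendsto f atTop (𝓝 ∞) ∧ (∀ t, g t < ∞) ∧
      ∀ t i, f t ≤ (φ i).omega 𝓥 (𝓦 i) t ∧ (φ i).rho 𝓥 (𝓦 i) t ≤ g t

end Functions

/-! ### Metric quotients -/

section Quotient

variable {H : Type*} [NormedAddCommGroup H] [InnerProductSpace ℂ H] [CompleteSpace H]
  (E : Submodule ℂ H) [CompleteSpace E]

/-- An operator on a closed subspace `E`, extended by `0` on the orthogonal complement. This
identifies `B(E)` with `R B(H) R`, where `R` is the projection onto `E`. -/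
def extend (T : E →L[ℂ] E) : H →L[ℂ] H :=
  E.subtypeL ∘L T ∘L E.orthogonalProjectionOnto

/-- The compression `R A R` of an operator, regarded as an operator on `E = R H`. -/
def compress (A : H →L[ℂ] H) : E →L[ℂ] E :=
  E.orthogonalProjectionOnto ∘L A ∘L E.subtypeL

variable {E}

theorem extend_apply (T : E →L[ℂ] E) (x : H) :
    extend E T x = T (E.orthogonalProjectionOnto x) := rfl

theorem extend_mul (S T : E →L[ℂ] E) : extend E (S * T) = extend E S * extend E T := by
  ext x
  simp [extend_apply]

theorem extend_star (T : E →L[ℂ] E) : extend E (star T) = star (extend E T) := by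
  simp only [extend, ContinuousLinearMap.star_eq_adjoint, ContinuousLinearMap.adjoint_comp,
    Submodule.adjoint_subtypeL, Submodule.adjoint_orthogonalProjectionOnto]
  rfl

theorem extend_add (S T : E →L[ℂ] E) : extend E (S + T) = extend E S + extend E T := by
  ext x
  simp [extend_apply]

theorem extend_smul (c : ℂ) (T : E →L[ℂ] E) : extend E (c • T) = c • extend E T := by
  ext x
  simp [extend_apply]

theorem extend_zero : extend E (0 : E →L[ℂ] E) = 0 := by
  ext x
  simp [extend_apply]

theorem extend_one : extend E (1 : E →L[ℂ] E) = E.starProjection := rfl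

theorem extend_injective : Function.Injective (extend E) := by
  intro S T h
  ext x
  have := congrArg (fun A : H →L[ℂ] H => A (x : H)) h
  simpa [extend_apply] using this

theorem extend_compress (A : H →L[ℂ] H) :
    extend E (compress E A) = E.starProjection * A * E.starProjection := rfl

theorem compress_extend (T : E →L[ℂ] E) : compress E (extend E T) = T := by
  ext x
  simp [compress, extend_apply]

theorem starProjection_mul_extend (T : E →L[ℂ] E) :
    E.starProjection * extend E T = extend E T := by
  rw [← extend_one, ← extend_mul, one_mul]

theorem extend_mul_starProjection (T : E →L[ℂ] E) :
    extend E T * E.starProjection = extend E T := by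
  rw [← extend_one, ← extend_mul, mul_one]

theorem mul_mem' {M : VonNeumannAlgebra H} {a b : H →L[ℂ] H} (ha : a ∈ M) (hb : b ∈ M) :
    a * b ∈ M := M.toStarSubalgebra.mul_mem ha hb

theorem centralizer_extend (M : VonNeumannAlgebra H)
    (hE : E.starProjection ∈ M) (hE' : E.starProjection ∈ M.commutant) :
    Set.centralizer {T : E →L[ℂ] E | extend E T ∈ M} = {T | extend E T ∈ M.commutant} := by
  ext T
  simp only [Set.mem_centralizer_iff, Set.mem_ofPred_eq, VonNeumannAlgebra.mem_commutant_iff]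
  rw [VonNeumannAlgebra.mem_commutant_iff] at hE'
  constructor
  · intro h A hA
    have h1 : extend E (compress E A) ∈ M := by
      rw [extend_compress]
      exact mul_mem' (mul_mem' hE hA) hE
    have h2 := congrArg (extend E) (h _ h1)
    rw [extend_mul, extend_mul, extend_compress] at h2
    calc A * extend E T = A * (E.starProjection * (E.starProjection * extend E T)) := by
          rw [starProjection_mul_extend, starProjection_mul_extend]
      _ = (A * E.starProjection) * E.starProjection * extend E T := by simp only [mul_assoc]
      _ = E.starProjection * A * E.starProjection * extend E T := by rw [hE' A hA]
      _ = extend E T * (E.starProjection * A * E.starProjection) := h2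
      _ = extend E T * (E.starProjection * (A * E.starProjection)) := by rw [mul_assoc _ A]
      _ = (extend E T * E.starProjection) * E.starProjection * A := by
          rw [hE' A hA]; simp only [mul_assoc]
      _ = extend E T * A := by rw [extend_mul_starProjection, extend_mul_starProjection]
  · intro h S hS
    apply extend_injective
    rw [extend_mul, extend_mul]
    exact h _ hS

/-- The reduced algebra `R M = {A ∈ M | A = R A R}` acting on `E = R H`, for the projection `R`
onto `E`, assumed to be a central projection of `M`. -/
def reducedAlgebra (M : VonNeumannAlgebra H) (hE : E.starProjection ∈ M)
    (hE' : E.starProjection ∈ M.commutant) : VonNeumannAlgebra E where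
  carrier := {T | extend E T ∈ M}
  mul_mem' {a b} ha hb := by
    simp only [Set.mem_ofPred_eq] at *
    rw [extend_mul]
    exact mul_mem' ha hb
  add_mem' {a b} ha hb := by
    simp only [Set.mem_ofPred_eq] at *
    rw [extend_add]
    exact M.toStarSubalgebra.add_mem ha hb
  algebraMap_mem' c := by
    simp only [Set.mem_ofPred_eq]
    rw [Algebra.algebraMap_eq_smul_one, extend_smul, extend_one]
    exact M.toStarSubalgebra.smul_mem hE c
  star_mem' {a} ha := by
    simp only [Set.mem_ofPred_eq] at *
    change extend E (star a) ∈ M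
    rw [extend_star]
    exact star_mem ha
  centralizer_centralizer' := by
    change Set.centralizer (Set.centralizer {T : E →L[ℂ] E | extend E T ∈ M}) =
      {T | extend E T ∈ M}
    rw [centralizer_extend M hE hE', centralizer_extend M.commutant hE' (by simpa using hE)]
    simp

theorem mem_reducedAlgebra {M : VonNeumannAlgebra H} {hE : E.starProjection ∈ M}
    {hE' : E.starProjection ∈ M.commutant} {T : E →L[ℂ] E} :
    T ∈ reducedAlgebra M hE hE' ↔ extend E T ∈ M := Iff.rfl

theorem continuous_extend :
    @Continuous _ _ (weakStar E) (weakStar H) (extend E) := by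
  letI := weakStar E
  refine continuous_weakStar_rng _ fun x y => ?_
  have h := continuous_weakStar_inner_ampl (H := E)
    (lp.mapCLM 2 (fun _ : ℕ => E.orthogonalProjectionOnto) (norm_nonneg _) (fun _ => le_rfl) x)
    (lp.mapCLM 2 (fun _ : ℕ => E.orthogonalProjectionOnto) (norm_nonneg _) (fun _ => le_rfl) y)
  convert h using 2 with T
  rw [lp.inner_eq_tsum, lp.inner_eq_tsum]
  refine tsum_congr fun i => ?_
  change ⟪x i, ((T (E.orthogonalProjectionOnto (y i)) : E) : H)⟫_ℂ =
    ⟪E.orthogonalProjectionOnto (x i), T (E.orthogonalProjectionOnto (y i))⟫_ℂ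
  rw [Submodule.inner_orthogonalProjectionOnto_eq_of_mem_right]

/-- The metric quotient of `(M, V)` by the central projection `R` onto `E`: the von Neumann
algebra `R M ⊆ B(E)`, with the quantum metric `R (V t) R`. As `R ∈ M' = V 0`, the space `R (V t) R`
consists of the operators in `V t` that live on `E`. -/
def QuantumMetric.quotient {M : VonNeumannAlgebra H} (𝓥 : QuantumMetric M)
    (hE : E.starProjection ∈ M) (hE' : E.starProjection ∈ M.commutant) :
    QuantumMetric (reducedAlgebra M hE hE') where
  V t :=
    { carrier := {T | extend E T ∈ 𝓥.V t}
      add_mem' := fun {a b} ha hb => by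
        simp only [Set.mem_ofPred_eq] at *
        rw [extend_add]
        exact add_mem ha hb
      zero_mem' := by
        simp only [Set.mem_ofPred_eq]
        rw [extend_zero]
        exact zero_mem _
      smul_mem' := fun c a ha => by
        simp only [Set.mem_ofPred_eq] at *
        rw [extend_smul]
        exact Submodule.smul_mem _ c ha }
  weakStar_closed t := by
    letI := weakStar E
    letI := weakStar H
    exact (𝓥.weakStar_closed t).preimage continuous_extend
  zero_eq := by
    rw [VonNeumannAlgebra.coe_commutant]
    change {T : E →L[ℂ] E | extend E T ∈ 𝓥.V 0} =
      Set.centralizer {T : E →L[ℂ] E | extend E T ∈ M}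
    rw [centralizer_extend M hE hE']
    ext T
    change extend E T ∈ (𝓥.V 0 : Set (H →L[ℂ] H)) ↔ _
    rw [𝓥.zero_eq]
    rfl
  star_mem t A hA := by
    change extend E (star A) ∈ 𝓥.V t
    rw [extend_star]
    exact 𝓥.star_mem t _ hA
  mul_mem s t A hA B hB := by
    change extend E (A * B) ∈ 𝓥.V (s + t)
    rw [extend_mul]
    exact 𝓥.mul_mem s t _ hA _ hB
  eq_iInf t := by
    ext T
    rw [Submodule.mem_iInf]
    change extend E T ∈ 𝓥.V t ↔ ∀ s : Set.Ioi t, extend E T ∈ 𝓥.V s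
    rw [𝓥.eq_iInf t, Submodule.mem_iInf]

/-- The space `R (V t) R`, written out. -/
theorem QuantumMetric.quotient_V {M : VonNeumannAlgebra H} (𝓥 : QuantumMetric M)
    (hE : E.starProjection ∈ M) (hE' : E.starProjection ∈ M.commutant) (t : ℝ≥0) :
    ((𝓥.quotient hE hE').V t : Set (E →L[ℂ] E)) = compress E '' (𝓥.V t) := by
  ext T
  constructor
  · intro h
    exact ⟨extend E T, h, compress_extend T⟩
  · rintro ⟨A, hA, rfl⟩
    change extend E (compress E A) ∈ 𝓥.V t
    have hR : E.starProjection ∈ 𝓥.V 0 := by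
      change _ ∈ (𝓥.V 0 : Set (H →L[ℂ] H))
      rw [𝓥.zero_eq]
      exact hE'
    rw [extend_compress]
    simpa using 𝓥.mul_mem _ _ _ (𝓥.mul_mem _ _ _ hR _ hA) _ hR

end Quotient

/-- `(N, W)` is a metric quotient of `(M, V)`: up to isometric isomorphism, it is the quotient
of `(M, V)` by some central projection of `M`. -/
def IsMetricQuotient {H : Type*} [NormedAddCommGroup H] [InnerProductSpace ℂ H] [CompleteSpace H]
    {K : Type*} [NormedAddCommGroup K] [InnerProductSpace ℂ K] [CompleteSpace K]
    {M : VonNeumannAlgebra H} (𝓥 : QuantumMetric M)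
    {N : VonNeumannAlgebra K} (𝓦 : QuantumMetric N) : Prop :=
  ∃ (E : Submodule ℂ H) (_ : CompleteSpace E) (hE : E.starProjection ∈ M)
    (hE' : E.starProjection ∈ M.commutant)
    (φ : QuantumFunction (reducedAlgebra M hE hE') N), φ.IsIsometricIso (𝓥.quotient hE hE') 𝓦

/-! ### Powers of operator systems -/

section Powers

variable {𝓐 : Type*} [Ring 𝓐] [StarRing 𝓐] [Algebra ℂ 𝓐] [StarModule ℂ 𝓐]

theorem star_mem_span {S : Set 𝓐} (hS : ∀ a ∈ S, star a ∈ S) {a : 𝓐}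
    (ha : a ∈ Submodule.span ℂ S) : star a ∈ Submodule.span ℂ S := by
  induction ha using Submodule.span_induction with
  | mem x hx => exact Submodule.subset_span (hS x hx)
  | zero => simp
  | add x y _ _ hx hy => rw [star_add]; exact add_mem hx hy
  | smul c x _ hx => rw [star_smul]; exact Submodule.smul_mem _ _ hx

theorem mem_pow_zero {S : Submodule ℂ 𝓐} {a : 𝓐} : a ∈ S ^ 0 ↔ ∃ c : ℂ, c • (1 : 𝓐) = a := by
  rw [pow_zero, Submodule.mem_one]
  simp only [Algebra.algebraMap_eq_smul_one]

theorem star_mem_pow {S : Submodule ℂ 𝓐} (hS : ∀ a ∈ S, star a ∈ S) (k : ℕ)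
    {a : 𝓐} (ha : a ∈ S ^ k) : star a ∈ S ^ k := by
  induction k generalizing a with
  | zero =>
    rw [mem_pow_zero] at *
    obtain ⟨c, rfl⟩ := ha
    exact ⟨star c, by simp⟩
  | succ k ih =>
    rw [pow_succ] at ha
    induction ha using Submodule.mul_induction_on' with
    | mem_mul_mem a ha b hb =>
      rw [star_mul, pow_succ']
      exact Submodule.mul_mem_mul (hS _ hb) (ih ha)
    | add x _ y _ hx hy => rw [star_add]; exact add_mem hx hy

theorem pow_mono_of_one_mem {S : Submodule ℂ 𝓐} (h1 : (1 : 𝓐) ∈ S) {k l : ℕ}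
    (h : k ≤ l) : S ^ k ≤ S ^ l :=
  pow_le_pow_right' (Submodule.one_le.2 h1) h

theorem mul_mem_pow_add {S : Submodule ℂ 𝓐} {k l : ℕ} {a b : 𝓐}
    (ha : a ∈ S ^ k) (hb : b ∈ S ^ l) : a * b ∈ S ^ (k + l) := by
  rw [pow_add]
  exact Submodule.mul_mem_mul ha hb

end Powers

/-! ### Quantum graphs and quantum expanders -/

section FiniteDim

variable {ι : Type*} [Fintype ι] [DecidableEq ι]

/-- The operator on `ℂ^ι` given by a matrix. -/
abbrev matOp : Matrix ι ι ℂ ≃⋆ₐ[ℂ] (EuclideanSpace ℂ ι →L[ℂ] EuclideanSpace ℂ ι) :=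
  Matrix.toEuclideanCLM (n := ι) (𝕜 := ℂ)

theorem matOp_symm_apply (A : EuclideanSpace ℂ ι →L[ℂ] EuclideanSpace ℂ ι) (i j : ι) :
    matOp.symm A i j = ⟪EuclideanSpace.single i (1 : ℂ), A (EuclideanSpace.single j 1)⟫_ℂ := by
  obtain ⟨B, rfl⟩ : ∃ B, matOp B = A := ⟨matOp.symm A, StarAlgEquiv.apply_symm_apply _ _⟩
  rw [StarAlgEquiv.symm_apply_apply]
  simp [EuclideanSpace.inner_single_left, matOp]

theorem isClosed_weakStar_of_finite
    (W : Submodule ℂ (EuclideanSpace ℂ ι →L[ℂ] EuclideanSpace ℂ ι)) :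
    IsClosed[weakStar (EuclideanSpace ℂ ι)]
      (W : Set (EuclideanSpace ℂ ι →L[ℂ] EuclideanSpace ℂ ι)) := by
  have hc : @Continuous _ _ (weakStar (EuclideanSpace ℂ ι)) _
      (fun A : EuclideanSpace ℂ ι →L[ℂ] EuclideanSpace ℂ ι => matOp.symm A) := by
    letI := weakStar (EuclideanSpace ℂ ι)
    refine continuous_pi fun i => continuous_pi fun j => ?_
    simp only [matOp_symm_apply]
    exact continuous_weakStar_inner _ _
  let W' : Submodule ℂ (Matrix ι ι ℂ) := W.comap (matOp (ι := ι)).toAlgEquiv.toLinearMap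
  have hW' : IsClosed (W' : Set (Matrix ι ι ℂ)) := W'.closed_of_finiteDimensional
  have : (W : Set (EuclideanSpace ℂ ι →L[ℂ] EuclideanSpace ℂ ι)) =
      (fun A => matOp.symm A) ⁻¹' (W' : Set (Matrix ι ι ℂ)) := by
    ext A
    change A ∈ W ↔ matOp (matOp.symm A) ∈ W
    rw [StarAlgEquiv.apply_symm_apply]
  rw [this]
  letI := weakStar (EuclideanSpace ℂ ι)
  exact hW'.preimage hc

/-- The full algebra `M_n = B(ℂ^n)`. -/
def fullAlgebra (n : ℕ) : VonNeumannAlgebra (EuclideanSpace ℂ (Fin n)) where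
  toStarSubalgebra := ⊤
  centralizer_centralizer' := by
    apply Set.eq_univ_of_univ_subset
    intro A _
    rw [Set.mem_centralizer_iff]
    intro B hB
    exact (Set.mem_centralizer_iff.1 hB A trivial).symm

theorem mem_commutant_fullAlgebra {n : ℕ}
    {A : EuclideanSpace ℂ (Fin n) →L[ℂ] EuclideanSpace ℂ (Fin n)} :
    A ∈ (fullAlgebra n).commutant ↔ ∃ c : ℂ, c • (1 : _ →L[ℂ] _) = A := by
  rw [VonNeumannAlgebra.mem_commutant_iff]
  constructor
  · intro h
    obtain ⟨B, rfl⟩ : ∃ B, matOp (ι := Fin n) B = A :=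
      ⟨matOp.symm A, StarAlgEquiv.apply_symm_apply _ _⟩
    have hB : B ∈ Set.range (Matrix.scalar (α := ℂ) (Fin n)) := by
      refine Matrix.mem_range_scalar_of_commute_single fun i j _ => ?_
      apply (matOp (ι := Fin n)).injective
      rw [map_mul, map_mul]
      exact h _ trivial
    obtain ⟨c, rfl⟩ := hB
    refine ⟨c, ?_⟩
    rw [← map_one (matOp (ι := Fin n)), ← map_smul]
    refine congrArg _ ?_
    ext i j
    simp [Matrix.one_apply, Matrix.diagonal_apply]
  · rintro ⟨c, rfl⟩ g _
    simp

/-- A Kraus representation `Φ X = ∑ j, K j * X * (K j)ᴴ` of a linear map on `M_n`, together with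
the fact that `Φ` preserves traces. The maps with such a representation are exactly the
completely positive trace preserving (CPTP) maps. -/
structure KrausRep {n : ℕ} (Φ : Matrix (Fin n) (Fin n) ℂ →ₗ[ℂ] Matrix (Fin n) (Fin n) ℂ) where
  /-- The number of Kraus operators. -/
  N : ℕ
  /-- The Kraus operators. -/
  K : Fin N → Matrix (Fin n) (Fin n) ℂ
  map_eq : ∀ X, Φ X = ∑ j, K j * X * (K j)ᴴ
  trace_map : ∀ X, (Φ X).trace = X.trace

namespace KrausRep

variable {n : ℕ} {Φ : Matrix (Fin n) (Fin n) ℂ →ₗ[ℂ] Matrix (Fin n) (Fin n) ℂ} (C : KrausRep Φ)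

/-- The operator system spanned by the operators `(K j)ᴴ * K i`. -/
def system : Submodule ℂ (EuclideanSpace ℂ (Fin n) →L[ℂ] EuclideanSpace ℂ (Fin n)) :=
  Submodule.span ℂ {A | ∃ i j, A = matOp ((C.K j)ᴴ * C.K i)}

theorem sum_eq_one : ∑ j, (C.K j)ᴴ * C.K j = 1 := by
  rw [Matrix.ext_iff_trace_mul_right]
  intro X
  rw [one_mul, ← C.trace_map X, C.map_eq X, Finset.sum_mul, Matrix.trace_sum, Matrix.trace_sum]
  refine Finset.sum_congr rfl fun j _ => ?_
  rw [mul_assoc, Matrix.trace_mul_comm]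

theorem one_mem_system : (1 : _ →L[ℂ] _) ∈ C.system := by
  rw [← map_one (matOp (ι := Fin n)), ← C.sum_eq_one, map_sum]
  exact sum_mem fun j _ => Submodule.subset_span ⟨j, j, rfl⟩

theorem star_mem_system {A} (hA : A ∈ C.system) : star A ∈ C.system := by
  refine star_mem_span ?_ hA
  rintro _ ⟨i, j, rfl⟩
  refine ⟨j, i, ?_⟩
  rw [← map_star, Matrix.star_eq_conjTranspose, Matrix.conjTranspose_mul,
    Matrix.conjTranspose_conjTranspose]

/-- The quantum (graph) metric on `M_n` associated to a CPTP map: `V t` is the `⌊t⌋`-th power of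
the operator system spanned by the `(K j)ᴴ * K i`; in particular `V 0 = ℂ ⬝ 1`. -/
def quantumMetric : QuantumMetric (fullAlgebra n) where
  V t := C.system ^ ⌊t⌋₊
  weakStar_closed t := isClosed_weakStar_of_finite _
  zero_eq := by
    ext A
    rw [Nat.floor_zero]
    exact mem_pow_zero.trans mem_commutant_fullAlgebra.symm
  star_mem t A hA := star_mem_pow (fun _ => C.star_mem_system) _ hA
  mul_mem s t A hA B hB :=
    pow_mono_of_one_mem C.one_mem_system (Nat.le_floor (by
      push_cast
      exact add_le_add (Nat.floor_le s.2) (Nat.floor_le t.2))) (mul_mem_pow_add hA hB)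
  eq_iInf t := by
    apply le_antisymm
    · exact le_iInf fun s => pow_mono_of_one_mem C.one_mem_system (Nat.floor_mono (le_of_lt s.2))
    · obtain ⟨s, hs, hs'⟩ : ∃ s, t < s ∧ ⌊s⌋₊ = ⌊t⌋₊ := by
        obtain ⟨s, h1, h2⟩ := exists_between (Nat.lt_floor_add_one t)
        refine ⟨s, h1, (Nat.floor_eq_iff s.2).2 ⟨?_, h2⟩⟩
        exact (Nat.floor_le t.2).trans h1.le
      refine (iInf_le _ (⟨s, hs⟩ : Set.Ioi t)).trans ?_
      change C.system ^ ⌊s⌋₊ ≤ _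
      rw [hs']

end KrausRep

/-- The Hilbert-Schmidt norm. -/
def hsNorm {n : ℕ} (X : Matrix (Fin n) (Fin n) ℂ) : ℝ := √(∑ i, ∑ j, ‖X i j‖ ^ 2)

/-- The `ε`-spectral gap condition for a map on `M_n`. -/
def HasSpectralGap {n : ℕ} (ε : ℝ)
    (Φ : Matrix (Fin n) (Fin n) ℂ →ₗ[ℂ] Matrix (Fin n) (Fin n) ℂ) : Prop :=
  ∀ X, hsNorm (Φ X - ((1 / (n : ℂ)) * X.trace) • 1) ≤
    (1 - ε) * hsNorm (X - ((1 / (n : ℂ)) * X.trace) • 1)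

/-- `Φ` is a `d`-regular `ε`-quantum expander. (Complete positivity is automatic from the second
clause, and so is trace preservation unless `d = 0`; the latter is also part of `KrausRep`.) -/
def IsQuantumExpander {n : ℕ} (d : ℕ) (ε : ℝ)
    (Φ : Matrix (Fin n) (Fin n) ℂ →ₗ[ℂ] Matrix (Fin n) (Fin n) ℂ) : Prop :=
  HasSpectralGap ε Φ ∧
  ∃ U : Fin d → Matrix.unitaryGroup (Fin n) ℂ,
    ∀ X, Φ X = (1 / (d : ℂ)) • ∑ j, (U j : Matrix (Fin n) (Fin n) ℂ) * X *
      (U j : Matrix (Fin n) (Fin n) ℂ)ᴴ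

end FiniteDim

/-! ### Classical graphs -/

section Classical

variable (X : Type*) [Fintype X] [DecidableEq X]

theorem centralizer_diagonal :
    Set.centralizer {A | ∃ f : X → ℂ, A = matOp (Matrix.diagonal f)} =
      {A | ∃ f : X → ℂ, A = matOp (Matrix.diagonal f)} := by
  ext A
  obtain ⟨B, rfl⟩ : ∃ B, matOp (ι := X) B = A :=
      ⟨matOp.symm A, StarAlgEquiv.apply_symm_apply _ _⟩
  rw [Set.mem_centralizer_iff]
  constructor
  · intro h
    refine ⟨fun i => B i i, ?_⟩
    congr 1
    ext i j
    by_cases hij : i = j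
    · subst hij; simp
    rw [Matrix.diagonal_apply_ne _ hij]
    have h1 := h _ ⟨Pi.single i 1, rfl⟩
    rw [← map_mul, ← map_mul] at h1
    have h2 := congrFun (congrFun ((matOp (ι := X)).injective h1) i) j
    rw [Matrix.diagonal_mul, Matrix.mul_diagonal] at h2
    simpa [Ne.symm hij] using h2
  · rintro ⟨f, hf⟩ _ ⟨g, rfl⟩
    rw [hf, ← map_mul, ← map_mul, Matrix.diagonal_mul_diagonal, Matrix.diagonal_mul_diagonal]
    simp only [mul_comm]

/-- The algebra `ℓ_∞(X)` of diagonal operators on `ℓ²(X)`, for a finite set `X`. -/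
def diagonalAlgebra : VonNeumannAlgebra (EuclideanSpace ℂ X) where
  carrier := {A | ∃ f : X → ℂ, A = matOp (Matrix.diagonal f)}
  mul_mem' := by
    rintro _ _ ⟨f, rfl⟩ ⟨g, rfl⟩
    exact ⟨fun i => f i * g i, by rw [← map_mul, Matrix.diagonal_mul_diagonal]⟩
  add_mem' := by
    rintro _ _ ⟨f, rfl⟩ ⟨g, rfl⟩
    exact ⟨fun i => f i + g i, by rw [← map_add, Matrix.diagonal_add]⟩
  algebraMap_mem' c := by
    refine ⟨fun _ => c, ?_⟩
    rw [Algebra.algebraMap_eq_smul_one, ← map_one (matOp (ι := X)), ← map_smul,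
      Matrix.smul_one_eq_diagonal]
  star_mem' := by
    rintro _ ⟨f, rfl⟩
    exact ⟨star f, by
      rw [← map_star, Matrix.star_eq_conjTranspose, Matrix.diagonal_conjTranspose]⟩
  centralizer_centralizer' := by
    change Set.centralizer (Set.centralizer {A | ∃ f : X → ℂ, A = matOp (Matrix.diagonal f)}) =
      {A | ∃ f : X → ℂ, A = matOp (Matrix.diagonal f)}
    rw [centralizer_diagonal, centralizer_diagonal]

variable {X}

/-- The canonical quantum metric on `ℓ_∞(X)` given by the path distance of a finite graph `G` on
`X`: an operator is in `V t` if its matrix vanishes at all pairs of vertices at distance greater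
than `t`. (Vertices in different components are at distance `∞`.) -/
def graphQuantumMetric (G : SimpleGraph X) : QuantumMetric (diagonalAlgebra X) where
  V t :=
    { carrier := {A | ∀ x y, (t : ℝ≥0∞) < (G.edist x y : ℝ≥0∞) → matOp.symm A x y = 0}
      add_mem' := by
        intro A B hA hB x y h
        rw [map_add, Matrix.add_apply, hA x y h, hB x y h, add_zero]
      zero_mem' := by
        intro x y _
        rw [map_zero, Matrix.zero_apply]
      smul_mem' := by
        intro c A hA x y h
        rw [map_smul, Matrix.smul_apply, hA x y h, smul_zero] }
  weakStar_closed t := isClosed_weakStar_of_finite _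
  zero_eq := by
    rw [VonNeumannAlgebra.coe_commutant]
    change {A | ∀ x y, ((0 : ℝ≥0) : ℝ≥0∞) < (G.edist x y : ℝ≥0∞) → matOp.symm A x y = 0} =
      Set.centralizer {A | ∃ f : X → ℂ, A = matOp (Matrix.diagonal f)}
    rw [centralizer_diagonal]
    ext A
    obtain ⟨B, rfl⟩ : ∃ B, matOp (ι := X) B = A :=
      ⟨matOp.symm A, StarAlgEquiv.apply_symm_apply _ _⟩
    simp only [Set.mem_ofPred_eq, StarAlgEquiv.symm_apply_apply, EmbeddingLike.apply_eq_iff_eq,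
      ENNReal.coe_zero]
    constructor
    · intro h
      refine ⟨fun i => B i i, ?_⟩
      ext i j
      by_cases hij : i = j
      · subst hij; simp
      rw [Matrix.diagonal_apply_ne _ hij]
      exact h i j (by exact_mod_cast SimpleGraph.edist_pos_of_ne hij)
    · rintro ⟨f, rfl⟩ x y h
      refine Matrix.diagonal_apply_ne _ ?_
      rintro rfl
      simp at h
  star_mem t A hA x y h := by
    have h1 : matOp.symm (star A) = star (matOp.symm A) := map_star (matOp (ι := X)).symm A
    rw [h1, Matrix.star_apply, hA y x (by rwa [SimpleGraph.edist_comm]), star_zero]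
  mul_mem s t A hA B hB x y h := by
    rw [map_mul, Matrix.mul_apply]
    refine Finset.sum_eq_zero fun z _ => ?_
    by_cases h1 : (s : ℝ≥0∞) < (G.edist x z : ℝ≥0∞)
    · rw [hA x z h1, zero_mul]
    by_cases h2 : (t : ℝ≥0∞) < (G.edist z y : ℝ≥0∞)
    · rw [hB z y h2, mul_zero]
    exfalso
    refine absurd h (not_lt.2 ?_)
    calc (G.edist x y : ℝ≥0∞) ≤ ((G.edist x z + G.edist z y : ℕ∞) : ℝ≥0∞) := by
          exact_mod_cast SimpleGraph.edist_triangle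
      _ = (G.edist x z : ℝ≥0∞) + (G.edist z y : ℝ≥0∞) := by rw [ENat.toENNReal_add]
      _ ≤ s + t := add_le_add (not_lt.1 h1) (not_lt.1 h2)
      _ = ((s + t : ℝ≥0) : ℝ≥0∞) := by rw [ENNReal.coe_add]
  eq_iInf t := by
    ext A
    rw [Submodule.mem_iInf]
    change (∀ x y, (t : ℝ≥0∞) < (G.edist x y : ℝ≥0∞) → matOp.symm A x y = 0) ↔
      ∀ s : Set.Ioi t, ∀ x y, ((s : ℝ≥0) : ℝ≥0∞) < (G.edist x y : ℝ≥0∞) → matOp.symm A x y = 0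
    constructor
    · intro h s x y hs
      exact h x y (lt_trans (by exact_mod_cast s.2) hs)
    · intro h x y ht
      obtain ⟨s, h1, h2⟩ := ENNReal.lt_iff_exists_nnreal_btwn.1 ht
      exact h ⟨s, by exact_mod_cast h1⟩ x y h2

/-- `G` is a `d`-regular `ε`-expander graph: every vertex has exactly `d` neighbours, and every
set `S` of at most half of the vertices has at least `ε |S|` boundary edges. -/
def IsClassicalExpander (d : ℕ) (ε : ℝ) (G : SimpleGraph X) : Prop :=
  (∀ x, (G.neighborSet x).ncard = d) ∧
  ∀ S : Finset X, 2 * S.card ≤ Fintype.card X →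
    ε * (S.card : ℝ) ≤ ({p : X × X | p.1 ∈ S ∧ p.2 ∉ S ∧ G.Adj p.1 p.2}.ncard : ℝ)

end Classical

end QuantumCoarse

end

/-! The obstruction is a dimension count. Expansion means that, for a fixed `c > 1`, the
`k`-neighbourhood `act (V k) W` of the range `W` of a projection has dimension at least `c ^ k * dim
W`, as long as this neighbourhood fills at most half of the space. Suppose that the asymptotic
dimension is at most `n`. Take `k` with `c ^ k > n + 1`, then `r` so large that projections at
distance at least `r` have images at distance more than `2 k`. Push a cover by `n + 1` families at
scale `r` to the `m`-th target. Within a family the `k`-neighbourhoods of the ranges are pairwise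
orthogonal, because `V k` is self-adjoint and `V k * V k ⊆ V (2 k)`. Their dimensions are bounded
independently of `m`, so for large `m` they are all small enough to expand, and one family spans at
most a fraction `1 / c ^ k` of the space. Hence `n + 1` families cannot span it, although quantum
functions send covers to covers by normality (`QuantumFunction.eq_zero_of_isCover`). This is
`asdim_eq_top_of_expansion`; it needs two inputs from the targets, expansion and bounded rank.

For quantum expanders, expansion comes from a mixing inequality (`KrausRep.finrank_mul_finrank_le`):
if `E` is the neighbourhood of `W`, the images under `Φ` of the projections onto `Eᗮ` and `W` have
product zero, which a spectral gap permits only if `E` is large compared with `W`. Bounded rank is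
where reflexivity enters: a projection of diameter at most `D` has its whole corner inside `V t` for
`t > D`, and `V t` has dimension at most `(d * d) ^ ⌊t⌋₊`.

For graphs, the projections of the diagonal algebra are sets of vertices, and the inputs are edge
expansion and bounded degree. For metric quotients, compression by the central projection does not
decrease distances and still controls diameters, so the quantum argument applies unchanged. -/

namespace QuantumCoarse

/-! ### Neighbourhoods of subspaces and dimension bounds -/

section Action

variable {H : Type*} [NormedAddCommGroup H] [InnerProductSpace ℂ H]

/-- The span of all the vectors `A x`, with `A ∈ S` and `x ∈ W`. -/
noncomputable def act (S : Submodule ℂ (H →L[ℂ] H)) (W : Submodule ℂ H) : Submodule ℂ H :=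
  Submodule.map₂ (ContinuousLinearMap.coeLM ℂ) S W

theorem apply_mem_act {S : Submodule ℂ (H →L[ℂ] H)} {W : Submodule ℂ H} {A : H →L[ℂ] H} {x : H}
    (hA : A ∈ S) (hx : x ∈ W) : A x ∈ act S W :=
  Submodule.apply_mem_map₂ (ContinuousLinearMap.coeLM ℂ) hA hx

theorem act_le {S : Submodule ℂ (H →L[ℂ] H)} {W U : Submodule ℂ H} :
    act S W ≤ U ↔ ∀ A ∈ S, ∀ x ∈ W, A x ∈ U :=
  Submodule.map₂_le

theorem act_act_le (S T : Submodule ℂ (H →L[ℂ] H)) (W : Submodule ℂ H) :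
    act S (act T W) ≤ act (S * T) W := by
  rw [act_le]
  intro A hA
  suffices act T W ≤ (act (S * T) W).comap (A : H →ₗ[ℂ] H) from fun x hx => this hx
  rw [act_le]
  intro B hB x hx
  exact apply_mem_act (A := A * B) (Submodule.mul_mem_mul hA hB) hx

/-- The image is a quotient of the tensor product. The bound serves both for neighbourhoods of
subspaces and for powers of operator systems. -/
theorem finrank_map₂_le {E F G : Type*} [AddCommGroup E] [Module ℂ E] [AddCommGroup F]
    [Module ℂ F] [AddCommGroup G] [Module ℂ G] (f : E →ₗ[ℂ] F →ₗ[ℂ] G) (S : Submodule ℂ E)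
    (W : Submodule ℂ F) [FiniteDimensional ℂ S] [FiniteDimensional ℂ W] :
    Module.finrank ℂ (Submodule.map₂ f S W) ≤ Module.finrank ℂ S * Module.finrank ℂ W := by
  rw [TensorProduct.map₂_eq_range_lift_comp_mapIncl, ← Module.finrank_tensorProduct]
  exact LinearMap.finrank_range_le _

theorem finrank_act_le [FiniteDimensional ℂ H] (S : Submodule ℂ (H →L[ℂ] H))
    (W : Submodule ℂ H) :
    Module.finrank ℂ (act S W) ≤ Module.finrank ℂ S * Module.finrank ℂ W :=
  finrank_map₂_le _ S W

theorem finrank_pow_le {A : Type*} [Ring A] [Algebra ℂ A] [FiniteDimensional ℂ A]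
    (S : Submodule ℂ A) (k : ℕ) :
    Module.finrank ℂ ↥(S ^ k) ≤ Module.finrank ℂ S ^ k := by
  induction k with
  | zero =>
    rw [pow_zero, pow_zero, Submodule.one_eq_span]
    exact (finrank_span_le_card _).trans (by simp)
  | succ k ih =>
    rw [pow_succ, pow_succ, Submodule.mul_eq_map₂]
    exact (finrank_map₂_le _ _ _).trans (Nat.mul_le_mul_right _ ih)

end Action

/-! ### Amplified operators and projections -/

section Stabilization

variable {H : Type*} [NormedAddCommGroup H] [InnerProductSpace ℂ H] [CompleteSpace H]

theorem ampl_mul (A B : H →L[ℂ] H) : ampl (A * B) = ampl A * ampl B := rfl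

theorem ampl_zero : ampl (0 : H →L[ℂ] H) = 0 := rfl

theorem ampl_injective : Function.Injective (ampl : (H →L[ℂ] H) → _) := by
  intro A B h
  ext x
  have h1 := congrArg (fun T : Stab H →L[ℂ] Stab H => T (lp.single 2 0 x) 0) h
  simpa [ampl_apply] using h1

theorem ampl_eq_zero_iff {A : H →L[ℂ] H} : ampl A = 0 ↔ A = 0 :=
  ⟨fun h => ampl_injective (h.trans ampl_zero.symm), fun h => h ▸ ampl_zero⟩

theorem star_ampl (A : H →L[ℂ] H) : star (ampl A) = ampl (star A) := by
  symm
  refine (ContinuousLinearMap.eq_adjoint_iff _ _).2 fun x y => ?_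
  rw [lp.inner_eq_tsum, lp.inner_eq_tsum]
  refine tsum_congr fun i => ?_
  rw [ampl_apply, ampl_apply, ContinuousLinearMap.star_eq_adjoint,
    ContinuousLinearMap.adjoint_inner_left]

theorem entry_ampl (A : H →L[ℂ] H) (i j : ℕ) : entry (ampl A) i j = if i = j then A else 0 := by
  ext x
  change A ((lp.single 2 j x : Stab H) i) = _
  rw [lp.single_apply]
  split_ifs with h
  · subst h; simp
  · simp [Pi.single_eq_of_ne h]

theorem isStarProjection_ampl {P : H →L[ℂ] H} (hP : IsStarProjection P) :
    IsStarProjection (ampl P) := by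
  refine ⟨?_, ?_⟩
  · rw [IsIdempotentElem, ← ampl_mul, hP.1.eq]
  · rw [IsSelfAdjoint, star_ampl, hP.2.star_eq]

theorem IsProj.ampl {M : VonNeumannAlgebra H} {P : H →L[ℂ] H} (hP : IsProj M P) :
    IsStabProj M (ampl P) := by
  refine ⟨isStarProjection_ampl hP.1, fun i j => ?_⟩
  rw [entry_ampl]
  split_ifs
  · exact hP.2
  · exact M.toStarSubalgebra.zero_mem

end Stabilization

/-! ### Joins of projections and linking operators -/

section Projections

variable {H : Type*} [NormedAddCommGroup H] [InnerProductSpace ℂ H] [CompleteSpace H]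

theorem mul_projSup_eq_zero {S : Set (H →L[ℂ] H)} {B : H →L[ℂ] H} (h : ∀ P ∈ S, B * P = 0) :
    B * projSup S = 0 := by
  have h1 : (⨆ P ∈ S, P.range) ≤ B.ker := by
    refine iSup₂_le fun P hP => ?_
    rintro _ ⟨x, rfl⟩
    exact congrArg (fun T : H →L[ℂ] H => T x) (h P hP)
  have h2 := Submodule.topologicalClosure_minimal _ h1 B.isClosed_ker
  ext x
  exact h2 (Submodule.starProjection_apply_mem _ x)

theorem isSelfAdjoint_projSup (S : Set (H →L[ℂ] H)) : IsSelfAdjoint (projSup S) :=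
  isStarProjection_starProjection.isSelfAdjoint

/-- Any two nonzero operators are linked by some operator. -/
theorem exists_mul_mul_ne_zero {A B : H →L[ℂ] H} (hA : A ≠ 0) (hB : B ≠ 0) :
    ∃ T : H →L[ℂ] H, A * T * B ≠ 0 := by
  obtain ⟨x, hx⟩ : ∃ x, A x ≠ 0 := by
    by_contra! h
    exact hA (ContinuousLinearMap.ext h)
  obtain ⟨y, hy⟩ : ∃ y, B y ≠ 0 := by
    by_contra! h
    exact hB (ContinuousLinearMap.ext h)
  refine ⟨(innerSL ℂ (B y)).smulRight x, fun h => ?_⟩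
  have h1 : A (⟪B y, B y⟫_ℂ • x) = 0 := congrArg (fun T : H →L[ℂ] H => T y) h
  rw [map_smul, smul_eq_zero, inner_self_eq_zero] at h1
  exact h1.elim hy hx

end Projections

/-! ### Distance, diameter and neighbourhoods of projections -/

namespace QuantumMetric

variable {H : Type*} [NormedAddCommGroup H] [InnerProductSpace ℂ H] [CompleteSpace H]
  {M : VonNeumannAlgebra H} (𝓥 : QuantumMetric M)

theorem V_mono {s t : ℝ≥0} (h : s ≤ t) : 𝓥.V s ≤ 𝓥.V t := by
  rcases h.eq_or_lt with rfl | h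
  · exact le_rfl
  · rw [𝓥.eq_iInf s]
    exact iInf_le _ (⟨t, h⟩ : Set.Ioi s)

theorem one_mem_V (t : ℝ≥0) : 1 ∈ 𝓥.V t := by
  refine 𝓥.V_mono (zero_le : 0 ≤ t) ?_
  change _ ∈ (𝓥.V 0 : Set (H →L[ℂ] H))
  rw [𝓥.zero_eq]
  exact M.commutant.toStarSubalgebra.one_mem

variable {𝓥}

theorem mul_mul_eq_zero_of_lt_dist {P Q A : H →L[ℂ] H} {t : ℝ≥0} (ht : t < 𝓥.dist P Q)
    (hA : A ∈ 𝓥.V t) : P * A * Q = 0 := by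
  by_contra h
  exact not_le_of_gt ht (iInf₂_le t ⟨A, hA, h⟩)

theorem le_dist {P Q : H →L[ℂ] H} {r : ℝ≥0∞}
    (h : ∀ t : ℝ≥0, t < r → ∀ A ∈ 𝓥.V t, P * A * Q = 0) : r ≤ 𝓥.dist P Q := by
  refine le_iInf₂ fun t ht => ?_
  obtain ⟨A, hA, hne⟩ := ht
  by_contra! hlt
  exact hne (h t hlt A hA)

theorem stabDist_ampl (P Q : H →L[ℂ] H) : 𝓥.stabDist (ampl P) (ampl Q) = 𝓥.dist P Q := by
  simp only [stabDist, dist, ← ampl_mul, ne_eq, ampl_eq_zero_iff]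

/-- The amplifications of `Q` and `R` compete in the supremum, since a rank one operator links `Q *
P` to `P * R`. This is the only property of the diameter on which the theorem depends. -/
theorem dist_le_diam {P Q R : H →L[ℂ] H} (hQ : IsProj M Q) (hR : IsProj M R)
    (hQP : Q * P ≠ 0) (hPR : P * R ≠ 0) : 𝓥.dist Q R ≤ 𝓥.diam P := by
  obtain ⟨T, hT⟩ := exists_mul_mul_ne_zero hQP hPR
  rw [← stabDist_ampl]
  refine le_iSup_of_le (ampl Q) (le_iSup_of_le (ampl R)
    (le_iSup_of_le ⟨hQ.ampl, hR.ampl, T, ?_⟩ le_rfl))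
  rw [← ampl_mul, ← ampl_mul, ne_eq, ampl_eq_zero_iff]
  simpa only [mul_assoc] using hT

/-- The identity has displacement zero, so projections at positive distance from `P` are orthogonal
to `P`, and so is their join. Positivity of `r` is essential. -/
theorem nhd_mul_self {r : ℝ≥0} (hr : 0 < r) {P : H →L[ℂ] H} (hP : IsStarProjection P) :
    𝓥.nhd r P * P = P := by
  have h : P * projSup {Q | IsProj M Q ∧ (r : ℝ≥0∞) ≤ 𝓥.dist P Q} = 0 := by
    refine mul_projSup_eq_zero fun Q hQ => ?_
    have := mul_mul_eq_zero_of_lt_dist (t := 0) (lt_of_lt_of_le (by exact_mod_cast hr) hQ.2)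
      (𝓥.one_mem_V 0)
    simpa using this
  have h' := congrArg star h
  rw [star_mul, star_zero, hP.2.star_eq, (isSelfAdjoint_projSup _).star_eq] at h'
  rw [nhd, sub_mul, one_mul, h', sub_zero]

/-- Projections with disjoint `r`-neighbourhoods are at distance at least `r`. -/
theorem le_dist_of_nhd_mul_nhd {r : ℝ≥0} (hr : 0 < r) {P Q : H →L[ℂ] H}
    (hQ : IsStarProjection Q) (h : 𝓥.nhd r P * 𝓥.nhd r Q = 0) :
    (r : ℝ≥0∞) ≤ 𝓥.dist P Q := by
  have h1 : 𝓥.nhd r P * Q = 0 := by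
    rw [← nhd_mul_self (𝓥 := 𝓥) hr hQ, ← mul_assoc, h, zero_mul]
  -- Now `Q` lies under the join of the projections at distance at least `r` from `P`, and for `t <
  -- r` the operator `P * A` kills each of these.
  rw [nhd, sub_mul, one_mul, sub_eq_zero] at h1
  refine le_dist fun t ht A hA => ?_
  rw [h1, ← mul_assoc, mul_projSup_eq_zero, zero_mul]
  exact fun R hR => mul_mul_eq_zero_of_lt_dist (ht.trans_le hR.2) hA

end QuantumMetric

/-! ### Weak-star limits and the preservation of covers -/

section Normality

variable {H : Type*} [NormedAddCommGroup H] [InnerProductSpace ℂ H] [CompleteSpace H]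
  {K : Type*} [NormedAddCommGroup K] [InnerProductSpace ℂ K] [CompleteSpace K]

/-- By the double commutant theorem: an inverse commutes with whatever the operator commutes with.
`Ring.inverse` of a non-unit is `0`, so no invertibility is required. -/
theorem inverse_mem {M : VonNeumannAlgebra H} {A : H →L[ℂ] H} (hA : A ∈ M) :
    Ring.inverse A ∈ M := by
  rw [← VonNeumannAlgebra.commutant_commutant M, VonNeumannAlgebra.mem_commutant_iff] at hA ⊢
  intro B hB
  by_cases hu : IsUnit A
  · obtain ⟨u, rfl⟩ := hu
    rw [Ring.inverse_unit]
    exact Commute.units_inv_right (hA B hB)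
  · rw [Ring.inverse_non_unit _ hu, mul_zero, zero_mul]

/-- Strong convergence gives termwise convergence of `∑ i, ⟪x i, T (y i)⟫`, and the uniform bound
supplies the summable majorant `C * ‖x i‖ * ‖y i‖`; thus nets are allowed, not only sequences. -/
theorem tendsto_weakStar_of_bounded {ι : Type*} {l : Filter ι}
    {T : ι → H →L[ℂ] H} {A : H →L[ℂ] H} {C : ℝ} (hC : ∀ i x, ‖T i x‖ ≤ C * ‖x‖)
    (h : ∀ x, Tendsto (fun i => T i x) l (𝓝 (A x))) :
    Tendsto T l (@nhds _ (weakStar H) A) := by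
  simp only [nhds_iInf, tendsto_iInf, nhds_induced, tendsto_comap_iff]
  intro x y
  simp only [Function.comp_def, lp.inner_eq_tsum]
  have hs : Summable fun i => C * (‖x i‖ * ‖y i‖) := by
    refine Summable.mul_left C ?_
    have hx := lp.memℓp x
    have hy := lp.memℓp y
    have h2 : (0 : ℝ) < (2 : ℝ≥0∞).toReal := by norm_num
    have hx' := (memℓp_gen_iff h2).1 hx
    have hy' := (memℓp_gen_iff h2).1 hy
    refine Summable.of_nonneg_of_le (fun i => by positivity) (fun i => ?_) (hx'.add hy')
    simp only [ENNReal.toReal_ofNat, Real.rpow_ofNat]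
    nlinarith [sq_nonneg (‖x i‖ - ‖y i‖), sq_nonneg (‖x i‖), sq_nonneg (‖y i‖)]
  refine tendsto_tsum_of_dominated_convergence hs (fun i => ?_) (Eventually.of_forall fun n i => ?_)
  · exact tendsto_const_nhds.inner (h (y i))
  · calc ‖⟪x i, T n (y i)⟫_ℂ‖ ≤ ‖x i‖ * ‖T n (y i)‖ := norm_inner_le_norm _ _
      _ ≤ ‖x i‖ * (C * ‖y i‖) := by gcongr; exact hC _ _
      _ = C * (‖x i‖ * ‖y i‖) := by ring

theorem isClosed_tendsto_zero {ι : Type*} {l : Filter ι} {T : ι → H →L[ℂ] H}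
    (hC : ∀ i x, ‖T i x‖ ≤ ‖x‖) : IsClosed {x | Tendsto (fun i => T i x) l (𝓝 0)} := by
  rw [← closure_subset_iff_isClosed]
  intro x hx
  rw [Set.mem_ofPred_eq, Metric.tendsto_nhds]
  intro ε hε
  obtain ⟨y, hy, hxy⟩ := Metric.mem_closure_iff.1 hx (ε / 2) (half_pos hε)
  filter_upwards [Metric.tendsto_nhds.1 hy (ε / 2) (half_pos hε)] with i hi
  rw [dist_zero_right] at hi ⊢
  calc ‖T i x‖ = ‖T i (x - y) + T i y‖ := by rw [map_sub, sub_add_cancel]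
    _ ≤ ‖T i (x - y)‖ + ‖T i y‖ := norm_add_le _ _
    _ < ε / 2 + ε / 2 := by
        refine add_lt_add_of_le_of_lt ((hC _ _).trans ?_) hi
        rw [← dist_eq_norm]; exact hxy.le
    _ = ε := add_halves ε

theorem isUnit_add_algebraMap {S : H →L[ℂ] H} (hS : 0 ≤ S) {η : ℝ} (hη : 0 < η) :
    IsUnit (S + (η : ℂ) • 1) := by
  have h : -η ∉ spectrum ℝ S := fun h => by
    have := spectrum_nonneg_of_nonneg hS h
    linarith
  rw [spectrum.notMem_iff] at h
  have h2 := h.neg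
  rw [Algebra.algebraMap_eq_smul_one] at h2
  convert h2 using 1
  rw [neg_sub, neg_smul, sub_neg_eq_add]
  rfl

theorem re_inner_add_of_add_smul_eq {S : H →L[ℂ] H} {η : ℝ} {x y : H}
    (h : S y + (η : ℂ) • y = (η : ℂ) • x) :
    (⟪S y, y⟫_ℂ).re + η * ‖y‖ ^ 2 = η * (⟪x, y⟫_ℂ).re := by
  have h1 := congrArg (fun z => (⟪z, y⟫_ℂ).re) h
  simp only [inner_add_left, inner_smul_left, Complex.add_re, Complex.conj_ofReal,
    Complex.re_ofReal_mul] at h1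
  have h2 : (⟪y, y⟫_ℂ).re = ‖y‖ ^ 2 := inner_self_eq_norm_sq (𝕜 := ℂ) y
  rwa [h2] at h1

/-- The estimates behind the strong convergence of `η (S + η)⁻¹` to the projection onto the kernel
of `S`. -/
theorem norm_le_of_add_smul_eq {S : H →L[ℂ] H} (hS : S.IsPositive) {η : ℝ} (hη : 0 < η) {x y : H}
    (h : S y + (η : ℂ) • y = (η : ℂ) • x) : ‖y‖ ≤ ‖x‖ := by
  have h1 := re_inner_add_of_add_smul_eq h
  have h2 : 0 ≤ (⟪S y, y⟫_ℂ).re := hS.re_inner_nonneg_left y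
  have h3 : (⟪x, y⟫_ℂ).re ≤ ‖x‖ * ‖y‖ := re_inner_le_norm (𝕜 := ℂ) x y
  by_contra! h4
  have h5 : 0 < ‖y‖ := (norm_nonneg x).trans_lt h4
  have h6 : η * (⟪x, y⟫_ℂ).re ≤ η * (‖x‖ * ‖y‖) := by gcongr
  have h7 : η * (‖x‖ * ‖y‖) < η * (‖y‖ * ‖y‖) := by gcongr
  nlinarith

/-- Pairing the equation with `y` and using `⟪S y, y⟫ ≥ ‖P y‖ ^ 2` and `⟪x, y⟫ = ⟪x, P y⟫` gives `‖P
y‖ ^ 2 + η ‖y‖ ^ 2 ≤ η ‖x‖ ‖P y‖`; completing the square removes `‖P y‖`. -/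
theorem norm_sq_le_of_add_smul_eq {S P : H →L[ℂ] H} (hP : IsStarProjection P) (hPS : P ≤ S)
    {η : ℝ} (hη : 0 < η) {x y : H} (hx : P x = x)
    (h : S y + (η : ℂ) • y = (η : ℂ) • x) : ‖y‖ ^ 2 ≤ η * ‖x‖ ^ 2 := by
  have h1 := re_inner_add_of_add_smul_eq h
  have hPP : ∀ u v, ⟪P u, v⟫_ℂ = ⟪u, P v⟫_ℂ := fun u v => by
    rw [← ContinuousLinearMap.adjoint_inner_right, ← ContinuousLinearMap.star_eq_adjoint,
      hP.2.star_eq]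
  have h2 : ‖P y‖ ^ 2 ≤ (⟪S y, y⟫_ℂ).re := by
    have := ((ContinuousLinearMap.le_def _ _).1 hPS).re_inner_nonneg_left y
    simp only [sub_apply, inner_sub_left, map_sub] at this
    have h3 : ⟪P y, y⟫_ℂ = ⟪P y, P y⟫_ℂ := by
      rw [← hPP]
      exact congrArg (fun T : H →L[ℂ] H => ⟪T y, y⟫_ℂ) hP.1.eq.symm
    rw [h3, inner_self_eq_norm_sq_to_K] at this
    norm_cast at this
    simpa using this
  have h3 : (⟪x, y⟫_ℂ).re ≤ ‖x‖ * ‖P y‖ := by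
    rw [← hx, hPP, hx]
    exact re_inner_le_norm (𝕜 := ℂ) x (P y)
  have h4 : η * (⟪x, y⟫_ℂ).re ≤ η * (‖x‖ * ‖P y‖) := by gcongr
  have h5 : η * ‖y‖ ^ 2 ≤ η * (η * ‖x‖ ^ 2) := by
    nlinarith [sq_nonneg (‖P y‖ - η * ‖x‖), sq_nonneg (‖P y‖), sq_nonneg (η * ‖x‖)]
  exact le_of_mul_le_mul_left h5 hη

variable {M : VonNeumannAlgebra H} {N : VonNeumannAlgebra K}

/-- Quantum functions preserve covers: a vector annihilated by the images of all the members of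
a cover vanishes. -/
theorem QuantumFunction.eq_zero_of_isCover (φ : QuantumFunction M N)
    {S : Set M.toStarSubalgebra} (hS : ∀ P ∈ S, IsStarProjection (P : H →L[ℂ] H))
    (hcov : QuantumMetric.IsCover (Subtype.val '' S)) {v : K}
    (hv : ∀ P ∈ S, (φ.toHom P : K →L[ℂ] K) v = 0) : v = 0 := by
  classical
  -- The net is indexed by a finite subfamily, whose sum `A` replaces its join, and a regularisation
  -- parameter `η > 0` tending to `0`.
  let η : Finset S × ℕ → ℝ := fun i => 1 / ((i.2 : ℝ) + 1)
  have hη : ∀ i, 0 < η i := fun i => by positivity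
  let A : Finset S × ℕ → M.toStarSubalgebra := fun i => ∑ P ∈ i.1, P.1
  have hval : ∀ i, ((A i : M.toStarSubalgebra) : H →L[ℂ] H) = ∑ P ∈ i.1, (P.1 : H →L[ℂ] H) :=
    fun i => map_sum M.toStarSubalgebra.subtype _ _
  have hpos : ∀ i, (0 : H →L[ℂ] H) ≤ A i := fun i => by
    rw [hval]
    exact Finset.sum_nonneg fun P _ => (hS P.1 P.2).nonneg
  let B : Finset S × ℕ → M.toStarSubalgebra := fun i => A i + (η i : ℂ) • 1
  have hu : ∀ i, IsUnit (B i : H →L[ℂ] H) := fun i => isUnit_add_algebraMap (hpos i) (hη i)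
  let R : Finset S × ℕ → M.toStarSubalgebra := fun i =>
    ⟨Ring.inverse (B i : H →L[ℂ] H), inverse_mem (B i).2⟩
  have hRB : ∀ i, R i * B i = 1 := fun i => Subtype.ext (Ring.inverse_mul_cancel _ (hu i))
  have hBR : ∀ i, (B i : H →L[ℂ] H) * (R i : H →L[ℂ] H) = 1 :=
    fun i => Ring.mul_inverse_cancel _ (hu i)
  -- `Y = η (A + η)⁻¹` approximates the projection onto the kernel of `A`. It belongs to `M`, and `1
  -- - Y = (A + η)⁻¹ A` is a left multiple of `A`.
  let Y : Finset S × ℕ → M.toStarSubalgebra := fun i => (η i : ℂ) • R i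
  have hY : ∀ i x, (A i : H →L[ℂ] H) ((Y i : H →L[ℂ] H) x) +
      (η i : ℂ) • (Y i : H →L[ℂ] H) x = (η i : ℂ) • x := fun i x => by
    have h := congrArg (fun T : H →L[ℂ] H => (η i : ℂ) • T x) (hBR i)
    change (η i : ℂ) • ((A i : H →L[ℂ] H) ((R i : H →L[ℂ] H) x) +
      (η i : ℂ) • ((R i : H →L[ℂ] H) x)) = (η i : ℂ) • x at h
    change (A i : H →L[ℂ] H) ((η i : ℂ) • (R i : H →L[ℂ] H) x) +
      (η i : ℂ) • ((η i : ℂ) • (R i : H →L[ℂ] H) x) = (η i : ℂ) • x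
    rw [← h, map_smul, smul_add]
  have hYle : ∀ i x, ‖(Y i : H →L[ℂ] H) x‖ ≤ ‖x‖ := fun i x =>
    norm_le_of_add_smul_eq ((ContinuousLinearMap.nonneg_iff_isPositive _).1 (hpos i)) (hη i)
      (hY i x)
  have hηlim : Tendsto η atTop (𝓝 0) :=
    (tendsto_one_div_add_atTop_nhds_zero_nat (𝕜 := ℝ)).comp
      (by rw [← prod_atTop_atTop_eq]; exact tendsto_snd)
  have hrange : ∀ P ∈ S, ∀ x, Tendsto (fun i => (Y i : H →L[ℂ] H) ((P : H →L[ℂ] H) x))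
      atTop (𝓝 0) := fun P hP x => by
    set z := (P : H →L[ℂ] H) x with hz
    have hPz : (P : H →L[ℂ] H) z = z :=
      congrArg (fun T : H →L[ℂ] H => T x) (hS P hP).1.eq
    have hsq : Tendsto (fun i => ‖(Y i : H →L[ℂ] H) z‖ ^ 2) atTop (𝓝 0) := by
      refine squeeze_zero' (Eventually.of_forall fun i => sq_nonneg _) ?_
        (by simpa using hηlim.mul_const (‖z‖ ^ 2))
      -- Once the finite subfamily contains `P`, its sum dominates `P`.
      filter_upwards [eventually_ge_atTop (({⟨P, hP⟩} : Finset S), 0)] with i hi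
      refine norm_sq_le_of_add_smul_eq (hS P hP) ?_ (hη i) hPz (hY i z)
      rw [hval]
      exact Finset.single_le_sum (f := fun Q : S => (Q.1 : H →L[ℂ] H))
        (fun Q _ => (hS Q.1 Q.2).nonneg) (hi.1 (Finset.mem_singleton_self _))
    have := hsq.sqrt
    simp only [Real.sqrt_sq (norm_nonneg _), Real.sqrt_zero] at this
    exact tendsto_zero_iff_norm_tendsto_zero.2 this
  -- As the `Y i` are contractions, the vectors with `Y i x → 0` form a closed subspace. It contains
  -- the ranges of all members of the cover, hence everything.
  have hlim : ∀ x, Tendsto (fun i => (Y i : H →L[ℂ] H) x) atTop (𝓝 0) := by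
    let W : Submodule ℂ H :=
      { carrier := {x | Tendsto (fun i => (Y i : H →L[ℂ] H) x) atTop (𝓝 0)}
        add_mem' := fun {x y} hx hy => by
          simp only [Set.mem_ofPred_eq, map_add]
          simpa using Tendsto.add hx hy
        zero_mem' := by simp
        smul_mem' := fun c x hx => by
          simp only [Set.mem_ofPred_eq, map_smul]
          simpa using Tendsto.const_smul hx c }
    have hW : (⨆ P ∈ Subtype.val '' S, (P : H →L[ℂ] H).range).topologicalClosure ≤ W := by
      refine Submodule.topologicalClosure_minimal _ (iSup₂_le ?_) (isClosed_tendsto_zero hYle)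
      rintro _ ⟨P, hP, rfl⟩ _ ⟨x, rfl⟩
      exact hrange P hP x
    intro x
    refine hW (Submodule.starProjection_eq_self_iff.1 ?_)
    exact congrArg (fun T : H →L[ℂ] H => T x) hcov
  have hweak : Tendsto (fun i => 1 - Y i) atTop
      (@nhds _ (TopologicalSpace.induced Subtype.val (weakStar H)) (1 : M.toStarSubalgebra)) := by
    rw [@nhds_induced _ _ (weakStar H), tendsto_comap_iff]
    refine tendsto_weakStar_of_bounded (C := 2) (fun i x => ?_) (fun x => ?_)
    · calc ‖x - (Y i : H →L[ℂ] H) x‖ ≤ ‖x‖ + ‖(Y i : H →L[ℂ] H) x‖ := norm_sub_le _ _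
        _ ≤ 2 * ‖x‖ := by linarith [hYle i x]
    · simpa using (tendsto_const_nhds (x := x)).sub (hlim x)
  have hcont : @Continuous _ _ (TopologicalSpace.induced Subtype.val (weakStar H)) _
      (fun T : M.toStarSubalgebra => ⟪v, (φ.toHom T : K →L[ℂ] K) v⟫_ℂ) :=
    @Continuous.comp _ _ _ (TopologicalSpace.induced Subtype.val (weakStar H))
      (TopologicalSpace.induced Subtype.val (weakStar K)) _ _ _
      (@Continuous.comp _ _ _ (TopologicalSpace.induced Subtype.val (weakStar K)) (weakStar K) _ _ _
        (continuous_weakStar_inner v v) continuous_induced_dom) φ.weakStar_continuous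
  have hlim2 := Tendsto.comp
    (@Continuous.tendsto _ _ (TopologicalSpace.induced Subtype.val (weakStar H)) _ _ hcont 1) hweak
  -- Each `φ (1 - Y i)` ends with `φ (A i)`, a sum of projections killing `v`; but `φ (1 - Y i)`
  -- tends to `1` weakly, which forces `⟪v, v⟫ = 0`.
  have hzero : ∀ i, (φ.toHom (1 - Y i) : K →L[ℂ] K) v = 0 := fun i => by
    have h1 : 1 - Y i = R i * A i := by
      rw [← hRB i]
      simp only [B, Y, mul_add, mul_smul_comm, mul_one, add_sub_cancel_right]
    rw [h1, map_mul]
    change (φ.toHom (R i) : K →L[ℂ] K) ((φ.toHom (A i) : K →L[ℂ] K) v) = 0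
    have h2 : (φ.toHom (A i) : K →L[ℂ] K) v = 0 := by
      have h3 : (φ.toHom (A i) : K →L[ℂ] K) = ∑ P ∈ i.1, (φ.toHom P.1 : K →L[ℂ] K) := by
        rw [map_sum]
        exact map_sum N.toStarSubalgebra.subtype _ _
      rw [h3, sum_apply]
      exact Finset.sum_eq_zero fun P _ => hv P.1 P.2
    rw [h2, map_zero]
  simp only [Function.comp_def, hzero, inner_zero_right, map_one] at hlim2
  have := tendsto_nhds_unique tendsto_const_nhds hlim2
  exact inner_self_eq_zero.1 this.symm

end Normality

/-! ### Dimension counts for orthogonal neighbourhoods -/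

section Orthogonality

variable {L : Type*} [NormedAddCommGroup L] [InnerProductSpace ℂ L]

theorem act_isOrtho_act {S : Submodule ℂ (L →L[ℂ] L)} {W U : Submodule ℂ L}
    (h : ∀ A ∈ S, ∀ B ∈ S, ∀ x ∈ W, ∀ y ∈ U, ⟪A x, B y⟫_ℂ = 0) : act S W ⟂ act S U := by
  refine act_le.2 fun A hA x hx => (Submodule.mem_orthogonal' _ _).2 ?_
  intro u hu
  suffices act S U ≤ (innerSL ℂ (A x)).ker from this hu
  exact act_le.2 fun B hB y hy => h A hA B hB x hx y hy

variable [FiniteDimensional ℂ L] {ι : Type*}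

theorem finrank_finset_sup_le (W : ι → Submodule ℂ L) (t : Finset ι) :
    Module.finrank ℂ ↥(t.sup W) ≤ ∑ i ∈ t, Module.finrank ℂ (W i) := by
  classical
  induction t using Finset.induction_on with
  | empty => simp
  | insert a t ha ih =>
    rw [Finset.sup_insert, Finset.sum_insert ha]
    exact (Submodule.finrank_add_le_finrank_add_finrank _ _).trans (Nat.add_le_add_left ih _)

theorem sum_finrank_le_of_isOrtho {U : ι → Submodule ℂ L}
    (hU : Pairwise fun i j => U i ⟂ U j) (t : Finset ι) :
    ∑ i ∈ t, Module.finrank ℂ (U i) ≤ Module.finrank ℂ L := by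
  classical
  suffices ∑ i ∈ t, Module.finrank ℂ (U i) ≤ Module.finrank ℂ ↥(t.sup U) from
    this.trans (Submodule.finrank_le _)
  induction t using Finset.induction_on with
  | empty => simp
  | insert a t ha ih =>
    rw [Finset.sup_insert, Finset.sum_insert ha]
    have hortho : t.sup U ≤ (U a)ᗮ := Finset.sup_le fun i hi =>
      hU (show i ≠ a by rintro rfl; exact ha hi)
    have hdisj : U a ⊓ t.sup U = ⊥ :=
      ((Submodule.orthogonal_disjoint (U a)).mono_right hortho).eq_bot
    have := Submodule.finrank_sup_add_finrank_inf_eq (U a) (t.sup U)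
    rw [hdisj, finrank_bot, add_zero] at this
    rw [this]
    exact Nat.add_le_add_left ih _

/-- If every `W i` admits an enlargement by a factor `c` and the enlargements are pairwise
orthogonal, then the `W i` together occupy at most a fraction `1 / c` of the space. -/
theorem mul_finrank_iSup_le {U W : ι → Submodule ℂ L} (hU : Pairwise fun i j => U i ⟂ U j)
    {c : ℝ} (hc : 0 ≤ c)
    (h : ∀ i, c * Module.finrank ℂ (W i) ≤ (Module.finrank ℂ (U i) : ℝ)) :
    c * (Module.finrank ℂ ↥(⨆ i, W i) : ℝ) ≤ Module.finrank ℂ L := by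
  -- The family may be infinite, but in finite dimension finitely many members already have the same
  -- span.
  obtain ⟨t, ht⟩ := CompleteLattice.IsCompactElement.exists_finset_of_le_iSup _
    ((Submodule.fg_iff_compact _).1 (IsNoetherian.noetherian (⨆ i, W i))) W le_rfl
  have h1 : Module.finrank ℂ ↥(⨆ i, W i) ≤ ∑ i ∈ t, Module.finrank ℂ (W i) := by
    rw [← Finset.sup_eq_iSup] at ht
    exact (Submodule.finrank_mono ht).trans (finrank_finset_sup_le W t)
  calc c * (Module.finrank ℂ ↥(⨆ i, W i) : ℝ)
      ≤ c * ∑ i ∈ t, (Module.finrank ℂ (W i) : ℝ) := by gcongr; exact_mod_cast h1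
    _ = ∑ i ∈ t, c * (Module.finrank ℂ (W i) : ℝ) := Finset.mul_sum _ _ _
    _ ≤ ∑ i ∈ t, (Module.finrank ℂ (U i) : ℝ) := Finset.sum_le_sum fun i _ => h i
    _ ≤ Module.finrank ℂ L := by exact_mod_cast sum_finrank_le_of_isOrtho hU t

end Orthogonality

/-! ### The expansion obstruction to finite asymptotic dimension -/

namespace QuantumMetric

section Expansion

variable {L : Type*} [NormedAddCommGroup L] [InnerProductSpace ℂ L] [CompleteSpace L]
  {N : VonNeumannAlgebra L} {𝓦 : QuantumMetric N}

/-- `⟪A P x, B Q y⟫ = ⟪x, P A* B Q y⟫`, and `A* B` has displacement at most `s + s`. -/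
theorem act_isOrtho_act_of_lt_dist {P Q : L →L[ℂ] L} (hP : IsStarProjection P) {s : ℝ≥0}
    (h : ((s + s : ℝ≥0) : ℝ≥0∞) < 𝓦.dist P Q) :
    act (𝓦.V s) P.range ⟂ act (𝓦.V s) Q.range := by
  refine act_isOrtho_act ?_
  rintro A hA B hB _ ⟨x, rfl⟩ _ ⟨y, rfl⟩
  have h1 := mul_mul_eq_zero_of_lt_dist h (𝓦.mul_mem _ _ _ (𝓦.star_mem _ _ hA) _ hB)
  have h2 : P (star A (B (Q y))) = 0 := congrArg (fun T : L →L[ℂ] L => T y) h1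
  change ⟪A (P x), B (Q y)⟫_ℂ = 0
  rw [← ContinuousLinearMap.adjoint_inner_right, ← ContinuousLinearMap.star_eq_adjoint,
    ← hP.2.star_eq, ContinuousLinearMap.star_eq_adjoint, ContinuousLinearMap.adjoint_inner_left,
    h2, inner_zero_right]

end Expansion

theorem asdim_eq_top_of_forall {H : Type*} [NormedAddCommGroup H] [InnerProductSpace ℂ H]
    [CompleteSpace H] {M : VonNeumannAlgebra H} {𝓥 : QuantumMetric M} (h : ∀ n, ¬ 𝓥.AsdimLE n) :
    𝓥.asdim = ⊤ :=
  iInf₂_eq_top.2 fun n hn => absurd hn (h n)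

/-- Obstruction to finite asymptotic dimension: the existence of quantum functions into finite
dimensional quantum metric spaces of arbitrarily large dimension, under which far apart projections
remain far apart and the images of projections of bounded diameter have neighbourhoods of bounded
rank, while all projections of these spaces with small neighbourhoods expand exponentially. -/
theorem asdim_eq_top_of_expansion {H : Type*} [NormedAddCommGroup H] [InnerProductSpace ℂ H]
    [CompleteSpace H] {M : VonNeumannAlgebra H} {𝓥 : QuantumMetric M}
    {L : ℕ → Type*} [∀ m, NormedAddCommGroup (L m)] [∀ m, InnerProductSpace ℂ (L m)]
    [∀ m, CompleteSpace (L m)] [∀ m, FiniteDimensional ℂ (L m)]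
    {N : ∀ m, VonNeumannAlgebra (L m)} {𝓦 : ∀ m, QuantumMetric (N m)}
    (φ : ∀ m, QuantumFunction M (N m)) {f : ℝ≥0 → ℝ≥0∞} (hf : Tendsto f atTop (𝓝 ∞))
    (hdist : ∀ m (P Q : M.toStarSubalgebra), IsStarProjection (P : H →L[ℂ] H) →
      IsStarProjection (Q : H →L[ℂ] H) → ∀ r : ℝ≥0, (r : ℝ≥0∞) ≤ 𝓥.dist P Q →
      f r ≤ (𝓦 m).dist ((φ m).toHom P : L m →L[ℂ] L m) ((φ m).toHom Q : L m →L[ℂ] L m))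
    (hgrowth : ∀ (D : ℝ≥0) (k : ℕ), ∃ B : ℕ, ∀ m (P : M.toStarSubalgebra),
      IsStarProjection (P : H →L[ℂ] H) → 𝓥.diam P ≤ D →
      Module.finrank ℂ (act ((𝓦 m).V k) ((φ m).toHom P : L m →L[ℂ] L m).range) ≤ B)
    {c : ℝ} (hc : 1 < c)
    (hexp : ∀ m (k : ℕ) (P : L m →L[ℂ] L m), IsProj (N m) P →
      2 * Module.finrank ℂ (act ((𝓦 m).V k) P.range) ≤ Module.finrank ℂ (L m) →
      c ^ k * (Module.finrank ℂ P.range : ℝ) ≤ Module.finrank ℂ (act ((𝓦 m).V k) P.range))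
    (hdim : Tendsto (fun m => Module.finrank ℂ (L m)) atTop atTop) :
    𝓥.asdim = ⊤ := by
  refine asdim_eq_top_of_forall fun n hn => ?_
  -- The order of choices matters: `k`, `r`, the cover and the rank bound `B` are all fixed before
  -- `m`, which is possible because the moduli do not depend on `m`.
  obtain ⟨k, hk⟩ := pow_unbounded_of_one_lt ((n : ℝ) + 1) hc
  obtain ⟨r, hr, hfr⟩ : ∃ r : ℝ≥0, 0 < r ∧ (((k : ℝ≥0) + k : ℝ≥0) : ℝ≥0∞) < f r :=
    ((eventually_gt_atTop 0).and (hf.eventually (lt_mem_nhds ENNReal.coe_lt_top))).exists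
  obtain ⟨𝓕, h𝓕, hcov⟩ := hn r hr
  choose hproj hbdd hdisj using h𝓕
  choose R hR using hbdd
  obtain ⟨B, hB⟩ := hgrowth (Finset.univ.sup R) k
  -- `2 * B` makes every neighbourhood at most half of the space; the extra `1` makes the dimension
  -- positive for the final cancellation.
  obtain ⟨m, hm⟩ := (hdim.eventually (eventually_ge_atTop (2 * B + 1))).exists
  let S : Fin (n + 1) → Set M.toStarSubalgebra := fun i => Subtype.val ⁻¹' 𝓕 i
  let W : ∀ i, S i → Submodule ℂ (L m) := fun i P => ((φ m).toHom P.1 : L m →L[ℂ] L m).range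
  have hφ : ∀ i (P : S i), IsProj (N m) ((φ m).toHom P.1 : L m →L[ℂ] L m) := fun i P => by
    have hP : IsStarProjection P.1 :=
      ⟨Subtype.ext (hproj i _ P.2).1.1, Subtype.ext (hproj i _ P.2).1.2⟩
    refine ⟨?_, ((φ m).toHom P.1).2⟩
    exact (hP.map (φ m).toHom).map (N m).toStarSubalgebra.subtype
  have hsmall : ∀ i, c ^ k * (Module.finrank ℂ ↥(⨆ P, W i P) : ℝ) ≤ Module.finrank ℂ (L m) := by
    intro i
    refine mul_finrank_iSup_le (U := fun P => act ((𝓦 m).V k) (W i P)) ?_ (by positivity) ?_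
    · intro P Q hPQ
      refine act_isOrtho_act_of_lt_dist (hφ i P).1 (hfr.trans_le ?_)
      refine hdist m P.1 Q.1 (hproj i _ P.2).1 (hproj i _ Q.2).1 r ?_
      refine le_dist_of_nhd_mul_nhd hr (hproj i _ Q.2).1 (hdisj i _ P.2 _ Q.2 fun h => hPQ ?_)
      exact Subtype.ext (Subtype.ext h)
    · intro P
      refine hexp m k _ (hφ i P) ?_
      have := hB m P.1 (hproj i _ P.2).1 ((hR i _ P.2).trans
        (by exact_mod_cast Finset.le_sup (f := R) (Finset.mem_univ i)))
      exact (Nat.mul_le_mul_left 2 this).trans (by omega)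
  -- A vector orthogonal to all the ranges is killed by all the image projections, hence vanishes
  -- because covers are preserved.
  have htop : (⊤ : Submodule ℂ (L m)) ≤ Finset.univ.sup fun i => ⨆ P, W i P := by
    refine (Submodule.orthogonal_eq_bot_iff.1 ((Submodule.eq_bot_iff _).2 fun v hv => ?_)).ge
    refine (φ m).eq_zero_of_isCover (S := ⋃ i, S i) ?_ ?_ ?_
    · intro P hP
      obtain ⟨i, hi⟩ := Set.mem_iUnion.1 hP
      exact (hproj i _ hi).1
    · convert hcov
      ext P
      simp only [Set.mem_image, Set.mem_iUnion, S, Set.mem_preimage]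
      constructor
      · rintro ⟨Q, ⟨i, hi⟩, rfl⟩; exact ⟨i, hi⟩
      · rintro ⟨i, hi⟩; exact ⟨⟨P, (hproj i _ hi).2⟩, ⟨i, hi⟩, rfl⟩
    · intro P hP
      obtain ⟨i, hi⟩ := Set.mem_iUnion.1 hP
      have hle : W i ⟨P, hi⟩ ≤ Finset.univ.sup fun i => ⨆ P, W i P :=
        (le_iSup (W i) ⟨P, hi⟩).trans (Finset.le_sup (f := fun i => ⨆ P, W i P) (Finset.mem_univ i))
      have hPsa := (hφ i ⟨P, hi⟩).1.2
      refine inner_self_eq_zero (𝕜 := ℂ).1 ?_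
      rw [← ContinuousLinearMap.adjoint_inner_left, ← ContinuousLinearMap.star_eq_adjoint,
        hPsa.star_eq]
      exact hv _ (hle ⟨_, rfl⟩)
  have hsum : (Module.finrank ℂ (L m) : ℝ) ≤ ∑ i, (Module.finrank ℂ ↥(⨆ P, W i P) : ℝ) := by
    have h1 := Submodule.finrank_mono htop
    rw [finrank_top] at h1
    exact_mod_cast h1.trans (finrank_finset_sup_le _ _)
  have hpos : (0 : ℝ) < Module.finrank ℂ (L m) := by exact_mod_cast (by omega)
  have h1 : c ^ k * (Module.finrank ℂ (L m) : ℝ) ≤ (n + 1) * Module.finrank ℂ (L m) := by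
    calc c ^ k * (Module.finrank ℂ (L m) : ℝ)
        ≤ c ^ k * ∑ i, (Module.finrank ℂ ↥(⨆ P, W i P) : ℝ) := by gcongr
      _ = ∑ i, c ^ k * (Module.finrank ℂ ↥(⨆ P, W i P) : ℝ) := Finset.mul_sum _ _ _
      _ ≤ ∑ i : Fin (n + 1), (Module.finrank ℂ (L m) : ℝ) := Finset.sum_le_sum fun i _ => hsmall i
      _ = (n + 1) * Module.finrank ℂ (L m) := by simp
  exact absurd (le_of_mul_le_mul_right h1 hpos) (not_le.2 hk)

end QuantumMetric

/-! ### Hilbert-Schmidt geometry of projections -/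

section HilbertSchmidt

variable {n : ℕ}

theorem hsNorm_nonneg (X : Matrix (Fin n) (Fin n) ℂ) : 0 ≤ hsNorm X := Real.sqrt_nonneg _

/-- Cauchy-Schwarz over pairs of indices. No adjoint is needed on `X`, since the Hilbert-Schmidt
norm is invariant under transposition. -/
theorem norm_trace_mul_le (X Y : Matrix (Fin n) (Fin n) ℂ) :
    ‖(X * Y).trace‖ ≤ hsNorm X * hsNorm Y := by
  have h1 : (X * Y).trace = ∑ p : Fin n × Fin n, X p.1 p.2 * Y p.2 p.1 := by
    rw [Fintype.sum_prod_type]; rfl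
  have hX : hsNorm X = √(∑ p : Fin n × Fin n, ‖X p.1 p.2‖ ^ 2) := by
    rw [Fintype.sum_prod_type]; rfl
  have hY : hsNorm Y = √(∑ p : Fin n × Fin n, ‖Y p.2 p.1‖ ^ 2) := by
    rw [Fintype.sum_prod_type, Finset.sum_comm]; rfl
  rw [h1, hX, hY]
  refine (norm_sum_le _ _).trans ?_
  simp only [norm_mul]
  exact Real.sum_mul_le_sqrt_mul_sqrt _ _ _

theorem hsNorm_sq (X : Matrix (Fin n) (Fin n) ℂ) : ((hsNorm X ^ 2 : ℝ) : ℂ) = (Xᴴ * X).trace := by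
  rw [hsNorm, Real.sq_sqrt (by positivity), Finset.sum_comm]
  push_cast
  refine Finset.sum_congr rfl fun i _ => ?_
  rw [Matrix.diag_apply, Matrix.mul_apply]
  refine Finset.sum_congr rfl fun j _ => ?_
  rw [Matrix.conjTranspose_apply, Complex.star_def, Complex.conj_mul']

/-- The matrix of the orthogonal projection onto a subspace. -/
noncomputable def projMatrix (W : Submodule ℂ (EuclideanSpace ℂ (Fin n))) :
    Matrix (Fin n) (Fin n) ℂ :=
  matOp.symm W.starProjection

variable (W : Submodule ℂ (EuclideanSpace ℂ (Fin n)))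

theorem matOp_projMatrix : matOp (projMatrix W) = W.starProjection :=
  StarAlgEquiv.apply_symm_apply _ _

theorem conjTranspose_projMatrix : (projMatrix W)ᴴ = projMatrix W := by
  apply (matOp (ι := Fin n)).injective
  change matOp (star (projMatrix W)) = matOp (projMatrix W)
  rw [map_star, matOp_projMatrix, (isStarProjection_starProjection (U := W)).2.star_eq]

theorem projMatrix_mul_self : projMatrix W * projMatrix W = projMatrix W := by
  apply (matOp (ι := Fin n)).injective
  change matOp (projMatrix W * projMatrix W) = matOp (projMatrix W)
  rw [map_mul, matOp_projMatrix, (isStarProjection_starProjection (U := W)).1.eq]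

theorem trace_projMatrix : (projMatrix W).trace = Module.finrank ℂ W := by
  have h1 : LinearMap.IsProj W (W.starProjection : EuclideanSpace ℂ (Fin n) →ₗ[ℂ] _) :=
    ⟨fun x => W.starProjection_apply_mem x, fun x hx => Submodule.starProjection_eq_self_iff.2 hx⟩
  rw [← h1.trace, ← matOp_projMatrix, Matrix.coe_toEuclideanCLM_eq_toEuclideanLin,
    Matrix.toEuclideanLin, Matrix.toLpLin_eq_toLin, Matrix.trace_toLin_eq]

/-- The Hilbert-Schmidt norm of the traceless part of a projection. -/
theorem hsNorm_projMatrix_sub_sq (hn : n ≠ 0) :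
    hsNorm (projMatrix W - ((1 / (n : ℂ)) * (projMatrix W).trace) • 1) ^ 2 =
      Module.finrank ℂ W * (n - Module.finrank ℂ W) / n := by
  have hn' : (n : ℂ) ≠ 0 := by exact_mod_cast hn
  apply Complex.ofReal_injective
  rw [hsNorm_sq, Matrix.conjTranspose_sub, conjTranspose_projMatrix, trace_projMatrix,
    Matrix.conjTranspose_smul, Matrix.conjTranspose_one, sub_mul, mul_sub, mul_sub,
    projMatrix_mul_self]
  simp only [Matrix.smul_mul, Matrix.mul_smul, mul_one, one_mul, Matrix.trace_sub,
    Matrix.trace_smul, trace_projMatrix, Matrix.trace_one, Fintype.card_fin, smul_eq_mul]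
  simp only [star_mul', star_div₀, star_one, star_natCast]
  push_cast
  field_simp
  ring

end HilbertSchmidt

/-! ### Spectral gap implies exponential expansion -/

section Expander

variable {n : ℕ} {Φ : Matrix (Fin n) (Fin n) ℂ →ₗ[ℂ] Matrix (Fin n) (Fin n) ℂ}

/-- In the product of the two Kraus sums every term contains some `(K i)ᴴ * K j` between the two
projections, and this operator carries `W` into the neighbourhood that the first projection kills.
This is the reason for defining the operator system by such products. -/
theorem KrausRep.map_mul_map_eq_zero (C : KrausRep Φ)
    (W : Submodule ℂ (EuclideanSpace ℂ (Fin n))) :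
    Φ (projMatrix (act C.system W)ᗮ) * Φ (projMatrix W) = 0 := by
  rw [C.map_eq, C.map_eq, Finset.sum_mul_sum]
  refine Finset.sum_eq_zero fun i _ => Finset.sum_eq_zero fun j _ => ?_
  have h : projMatrix (act C.system W)ᗮ * ((C.K i)ᴴ * C.K j) * projMatrix W = 0 := by
    apply (matOp (ι := Fin n)).injective
    change matOp (projMatrix (act C.system W)ᗮ * ((C.K i)ᴴ * C.K j) * projMatrix W) = matOp 0
    rw [map_mul, map_mul, matOp_projMatrix, matOp_projMatrix, map_zero]
    ext1 x
    refine (Submodule.starProjection_apply_eq_zero_iff _).2 ?_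
    rw [Submodule.orthogonal_orthogonal]
    exact apply_mem_act (Submodule.subset_span ⟨j, i, rfl⟩) (W.starProjection_apply_mem x)
  calc C.K i * projMatrix (act C.system W)ᗮ * (C.K i)ᴴ * (C.K j * projMatrix W * (C.K j)ᴴ)
      = C.K i * (projMatrix (act C.system W)ᗮ * ((C.K i)ᴴ * C.K j) * projMatrix W) * (C.K j)ᴴ := by
        simp only [mul_assoc]
    _ = 0 := by rw [h, mul_zero, zero_mul]

/-- The expander mixing inequality for a subspace and the complement of its neighbourhood. -/
theorem KrausRep.finrank_mul_finrank_le (C : KrausRep Φ) {ε : ℝ} (hΦ : HasSpectralGap ε Φ)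
    (hε : ε < 1) (W : Submodule ℂ (EuclideanSpace ℂ (Fin n))) :
    (Module.finrank ℂ W : ℝ) * (n - Module.finrank ℂ (act C.system W)) ≤
      (1 - ε) ^ 4 * ((n - Module.finrank ℂ W) * Module.finrank ℂ (act C.system W)) := by
  set E := act C.system W
  have hp : (Module.finrank ℂ W : ℝ) ≤ n := by
    have := W.finrank_le; rw [finrank_euclideanSpace_fin] at this; exact_mod_cast this
  have hq : (Module.finrank ℂ Eᗮ : ℝ) = n - Module.finrank ℂ E := by
    have := E.finrank_add_finrank_orthogonal
    rw [finrank_euclideanSpace_fin] at this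
    rw [eq_sub_iff_add_eq']
    exact_mod_cast this
  have he : (Module.finrank ℂ E : ℝ) = n - Module.finrank ℂ Eᗮ := by rw [hq]; ring
  have he0 : (0 : ℝ) ≤ Module.finrank ℂ E := Nat.cast_nonneg _
  rw [← hq]
  -- The degenerate case is split off because the main case ends by cancelling `dim W * dim Eᗮ`.
  rcases Nat.eq_zero_or_pos (Module.finrank ℂ W * Module.finrank ℂ Eᗮ) with h0 | hpos
  · have h0' : (Module.finrank ℂ W : ℝ) * Module.finrank ℂ Eᗮ = 0 := by exact_mod_cast h0
    rw [h0']
    have := sub_nonneg.2 hp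
    positivity
  have hpos' : (0 : ℝ) < Module.finrank ℂ W * Module.finrank ℂ Eᗮ := by exact_mod_cast hpos
  have hp0 : (0 : ℝ) < Module.finrank ℂ W := pos_of_mul_pos_left hpos' (Nat.cast_nonneg _)
  have hn0 : (0 : ℝ) < n := hp0.trans_le hp
  have hn : n ≠ 0 := by exact_mod_cast hn0.ne'
  have hn' : (n : ℂ) ≠ 0 := by exact_mod_cast hn
  have hA := hΦ (projMatrix W)
  have hB := hΦ (projMatrix Eᗮ)
  have htr := norm_trace_mul_le
    (Φ (projMatrix Eᗮ) - ((1 / (n : ℂ)) * (projMatrix Eᗮ).trace) • 1)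
    (Φ (projMatrix W) - ((1 / (n : ℂ)) * (projMatrix W).trace) • 1)
  -- The product of the images vanishes and `Φ` preserves traces, so only the scalar parts
  -- contribute to the trace of the product of the traceless parts.
  have heq : ((Φ (projMatrix Eᗮ) - ((1 / (n : ℂ)) * (projMatrix Eᗮ).trace) • 1) *
      (Φ (projMatrix W) - ((1 / (n : ℂ)) * (projMatrix W).trace) • 1)).trace =
      ((-(Module.finrank ℂ W * Module.finrank ℂ Eᗮ / n : ℝ) : ℝ) : ℂ) := by
    rw [sub_mul, mul_sub, mul_sub, C.map_mul_map_eq_zero]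
    simp only [Matrix.smul_mul, Matrix.mul_smul, mul_one, one_mul, Matrix.trace_sub,
      Matrix.trace_smul, C.trace_map, trace_projMatrix, Matrix.trace_one, Fintype.card_fin,
      smul_eq_mul, Matrix.trace_zero]
    push_cast
    field_simp
    ring
  rw [heq, Complex.norm_real, norm_neg, Real.norm_of_nonneg (by positivity)] at htr
  have h1 := htr.trans (mul_le_mul hB hA (hsNorm_nonneg _)
    (mul_nonneg (by linarith) (hsNorm_nonneg _)))
  have h2 := pow_le_pow_left₀ (by positivity) h1 2
  rw [mul_pow, mul_pow, mul_pow, hsNorm_projMatrix_sub_sq _ hn, hsNorm_projMatrix_sub_sq _ hn,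
    ← he] at h2
  -- With `p = dim W` and `q = dim Eᗮ`, the squared estimate reads `(p q / n) ^ 2 ≤ (1 - ε) ^ 4 * (q
  -- (n - q) / n) * (p (n - p) / n)`; the factor `p q / n ^ 2` is cancelled.
  refine le_of_mul_le_mul_left ?_ (div_pos hpos' (pow_pos hn0 2))
  convert h2 using 1
  · field_simp
  · field_simp

/-- With `κ = (1 - ε) ^ 4`, `p = dim W` and `e` the dimension of the neighbourhood, mixing says `p n
- (1 - κ) p e ≤ κ n e`. Inserting `e ≤ n / 2` on the left gives the ratio `(1 + κ) / (2 κ)`, which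
exceeds `1` when `κ < 1`. -/
theorem KrausRep.mul_finrank_le (C : KrausRep Φ) {ε : ℝ} (hΦ : HasSpectralGap ε Φ)
    (hε0 : 0 < ε) (hε : ε < 1) (W : Submodule ℂ (EuclideanSpace ℂ (Fin n)))
    (hW : 2 * Module.finrank ℂ (act C.system W) ≤ n) :
    (1 + (1 - ε) ^ 4) / (2 * (1 - ε) ^ 4) * (Module.finrank ℂ W : ℝ) ≤
      Module.finrank ℂ (act C.system W) := by
  have h := C.finrank_mul_finrank_le hΦ hε W
  have hp : (Module.finrank ℂ W : ℝ) ≤ n := by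
    have := W.finrank_le; rw [finrank_euclideanSpace_fin] at this; exact_mod_cast this
  have he : 2 * (Module.finrank ℂ (act C.system W) : ℝ) ≤ n := by exact_mod_cast hW
  have hp0 : (0 : ℝ) ≤ (Module.finrank ℂ W : ℝ) := Nat.cast_nonneg _
  have he0 : (0 : ℝ) ≤ (Module.finrank ℂ (act C.system W) : ℝ) := Nat.cast_nonneg _
  generalize (Module.finrank ℂ W : ℝ) = p at *
  generalize (Module.finrank ℂ (act C.system W) : ℝ) = e at *
  have hκ0 : 0 < (1 - ε) ^ 4 := pow_pos (by linarith) 4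
  have hκ1 : (1 - ε) ^ 4 ≤ 1 := pow_le_one₀ (by linarith) (by linarith)
  generalize (1 - ε) ^ 4 = κ at *
  rcases (hp0.trans hp).eq_or_lt with hn | hn
  · have : p = 0 := le_antisymm (hp.trans hn.ge) hp0
    rw [this, mul_zero]
    exact he0
  rw [div_mul_eq_mul_div, div_le_iff₀ (by positivity)]
  refine le_of_mul_le_mul_left ?_ hn
  nlinarith [mul_le_mul_of_nonneg_left he (mul_nonneg (sub_nonneg.2 hκ1) hp0)]

/-- Powers of the operator system of a quantum expander expand exponentially. -/
theorem KrausRep.pow_mul_finrank_le (C : KrausRep Φ) {ε : ℝ} (hΦ : HasSpectralGap ε Φ)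
    (hε0 : 0 < ε) (hε : ε < 1) (W : Submodule ℂ (EuclideanSpace ℂ (Fin n))) (k : ℕ)
    (hW : 2 * Module.finrank ℂ (act (C.system ^ k) W) ≤ n) :
    ((1 + (1 - ε) ^ 4) / (2 * (1 - ε) ^ 4)) ^ k * (Module.finrank ℂ W : ℝ) ≤
      Module.finrank ℂ (act (C.system ^ k) W) := by
  have hκ0 : 0 < (1 - ε) ^ 4 := pow_pos (by linarith) 4
  induction k with
  | zero =>
    rw [pow_zero, one_mul]
    have : W ≤ act (C.system ^ 0) W := fun x hx => by
      have := apply_mem_act (A := 1) (mem_pow_zero.2 ⟨1, one_smul ℂ _⟩ : 1 ∈ C.system ^ 0) hx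
      exact this
    exact_mod_cast Submodule.finrank_mono this
  | succ k ih =>
    have hle : act C.system (act (C.system ^ k) W) ≤ act (C.system ^ (k + 1)) W :=
      (act_act_le _ _ _).trans (Submodule.map₂_le_map₂_left (pow_succ' C.system k).ge)
    -- Neighbourhoods increase with `k` because the system contains `1`, so the half-space bound at
    -- the last stage holds at all earlier ones.
    have hle' : act (C.system ^ k) W ≤ act C.system (act (C.system ^ k) W) := fun x hx =>
      apply_mem_act (A := 1) C.one_mem_system hx
    have h1 := Submodule.finrank_mono hle
    have h2 := Submodule.finrank_mono hle'
    have h3 := ih (by omega)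
    have h4 := C.mul_finrank_le hΦ hε0 hε (act (C.system ^ k) W) (by omega)
    calc ((1 + (1 - ε) ^ 4) / (2 * (1 - ε) ^ 4)) ^ (k + 1) * (Module.finrank ℂ W : ℝ)
        = (1 + (1 - ε) ^ 4) / (2 * (1 - ε) ^ 4) *
          (((1 + (1 - ε) ^ 4) / (2 * (1 - ε) ^ 4)) ^ k * (Module.finrank ℂ W : ℝ)) := by ring
      _ ≤ (1 + (1 - ε) ^ 4) / (2 * (1 - ε) ^ 4) *
          (Module.finrank ℂ (act (C.system ^ k) W) : ℝ) := by gcongr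
      _ ≤ Module.finrank ℂ (act C.system (act (C.system ^ k) W)) := h4
      _ ≤ Module.finrank ℂ (act (C.system ^ (k + 1)) W) := by exact_mod_cast h1

end Expander

/-! ### Independence of the Kraus representation -/

section KrausSpan

variable {n : ℕ}

/-- The span of the Kraus operators is determined by the map. -/
theorem mem_span_of_sum_conj_eq {ι κ : Type*} [Fintype ι] [Fintype κ] {c : ℂ}
    (K : ι → Matrix (Fin n) (Fin n) ℂ) (U : κ → Matrix (Fin n) (Fin n) ℂ)
    (h : ∀ X, ∑ j, K j * X * (K j)ᴴ = c • ∑ j, U j * X * (U j)ᴴ) (i : ι) :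
    K i ∈ Submodule.span ℂ (Set.range U) := by
  by_contra hi
  -- A functional separating `K i` from the span of the `U j`.
  obtain ⟨f, hf, hf'⟩ := Submodule.exists_dual_map_eq_bot_of_notMem hi inferInstance
  have hfU : ∀ j, f (U j) = 0 := fun j => by
    have : f (U j) ∈ (Submodule.span ℂ (Set.range U)).map f :=
      ⟨U j, Submodule.subset_span ⟨j, rfl⟩, rfl⟩
    rwa [hf', Submodule.mem_bot] at this
  have hfA : ∀ A : Matrix (Fin n) (Fin n) ℂ,
      f A = ∑ p : Fin n × Fin n, A p.1 p.2 * f (Matrix.single p.1 p.2 1) := fun A => by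
    conv_lhs => rw [Matrix.matrix_eq_sum_single A]
    rw [Fintype.sum_prod_type]
    simp only [map_sum]
    refine Finset.sum_congr rfl fun a _ => Finset.sum_congr rfl fun b _ => ?_
    rw [← smul_eq_mul, ← map_smul, Matrix.smul_single, smul_eq_mul, mul_one]
  -- `|f A| ^ 2` is a fixed linear combination of entries of the matrices `A * X * Aᴴ`. Summing over
  -- Kraus operators, `∑ |f (K j)| ^ 2` depends only on the map, so it equals `c * ∑ |f (U j)| ^ 2 =
  -- 0`.
  have hsq : ∀ A : Matrix (Fin n) (Fin n) ℂ, f A * star (f A) =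
      ∑ p : Fin n × Fin n, ∑ q : Fin n × Fin n, f (Matrix.single p.1 p.2 1) *
        star (f (Matrix.single q.1 q.2 1)) *
        (A * Matrix.single p.2 q.2 1 * Aᴴ : Matrix (Fin n) (Fin n) ℂ) p.1 q.1 := by
    intro A
    have hentry : ∀ p q : Fin n × Fin n,
        (A * Matrix.single p.2 q.2 1 * Aᴴ : Matrix (Fin n) (Fin n) ℂ) p.1 q.1 =
        A p.1 p.2 * star (A q.1 q.2) := fun p q => by
      rw [mul_assoc, Matrix.mul_apply, Finset.sum_eq_single p.2]
      · rw [Matrix.single_mul_apply_same, one_mul, Matrix.conjTranspose_apply]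
      · intro b _ hb
        rw [Matrix.single_mul_apply_of_ne _ _ _ _ _ hb, mul_zero]
      · simp
    rw [hfA A, star_sum, Finset.sum_mul_sum]
    refine Finset.sum_congr rfl fun p _ => Finset.sum_congr rfl fun q _ => ?_
    rw [hentry, star_mul']
    ring
  have hsum : ∑ j, f (K j) * star (f (K j)) = c * ∑ j, f (U j) * star (f (U j)) := by
    simp only [hsq]
    rw [Finset.sum_comm, Finset.sum_comm (s := (Finset.univ : Finset κ)), Finset.mul_sum]
    refine Finset.sum_congr rfl fun p _ => ?_
    rw [Finset.sum_comm, Finset.sum_comm (s := (Finset.univ : Finset κ)), Finset.mul_sum]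
    refine Finset.sum_congr rfl fun q _ => ?_
    rw [← Finset.mul_sum, ← Finset.mul_sum, mul_left_comm]
    congr 1
    have := congrArg (fun X : Matrix (Fin n) (Fin n) ℂ => X p.1 q.1) (h (Matrix.single p.2 q.2 1))
    simpa [Matrix.sum_apply] using this
  simp only [hfU, zero_mul, Finset.sum_const_zero, mul_zero, Complex.star_def, Complex.mul_conj]
    at hsum
  rw [← Complex.ofReal_sum, Complex.ofReal_eq_zero,
    Finset.sum_eq_zero_iff_of_nonneg fun j _ => Complex.normSq_nonneg _] at hsum
  exact hi (absurd (Complex.normSq_eq_zero.1 (hsum i (Finset.mem_univ i))) (by assumption))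

variable {Φ : Matrix (Fin n) (Fin n) ℂ →ₗ[ℂ] Matrix (Fin n) (Fin n) ℂ}

/-- The representation may have any number of Kraus operators, but they all lie in the span of the
`d` unitaries; the system therefore sits in a product of two spaces of dimension at most `d`. -/
theorem KrausRep.finrank_system_le (C : KrausRep Φ) {d : ℕ} {ε : ℝ}
    (h : IsQuantumExpander d ε Φ) : Module.finrank ℂ C.system ≤ d * d := by
  obtain ⟨-, U, hU⟩ := h
  set P := Submodule.span ℂ (Set.range fun j => (U j : Matrix (Fin n) (Fin n) ℂ)) with hP
  set Q := Submodule.span ℂ (Set.range fun j => (U j : Matrix (Fin n) (Fin n) ℂ)ᴴ) with hQ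
  have hK : ∀ i, C.K i ∈ P := mem_span_of_sum_conj_eq C.K _ fun X => (C.map_eq X).symm.trans (hU X)
  have hstar : ∀ A ∈ P, Aᴴ ∈ Q := fun A hA => by
    induction hA using Submodule.span_induction with
    | mem x hx => obtain ⟨j, rfl⟩ := hx; exact Submodule.subset_span ⟨j, rfl⟩
    | zero => simp
    | add x y _ _ hx hy => rw [Matrix.conjTranspose_add]; exact add_mem hx hy
    | smul c x _ hx => rw [Matrix.conjTranspose_smul]; exact Submodule.smul_mem _ _ hx
  have hle : C.system ≤ (Q * P).map (matOp (ι := Fin n)).toAlgEquiv.toLinearMap := by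
    refine Submodule.span_le.2 ?_
    rintro _ ⟨i, j, rfl⟩
    exact ⟨_, Submodule.mul_mem_mul (hstar _ (hK j)) (hK i), rfl⟩
  calc Module.finrank ℂ C.system ≤ _ := Submodule.finrank_mono hle
    _ ≤ Module.finrank ℂ ↥(Q * P) := Submodule.finrank_map_le _ _
    _ ≤ Module.finrank ℂ Q * Module.finrank ℂ P := by
        rw [Submodule.mul_eq_map₂]; exact finrank_map₂_le _ _ _
    _ ≤ d * d := Nat.mul_le_mul ((finrank_range_le_card _).trans_eq (Fintype.card_fin d))
        ((finrank_range_le_card _).trans_eq (Fintype.card_fin d))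

end KrausSpan

/-! ### Reflexivity and the rank of bounded projections -/

section Reflexive

variable {L : Type*} [NormedAddCommGroup L] [InnerProductSpace ℂ L] [CompleteSpace L]

/-- For a fixed nonzero `e` in the range of `P`, the map from `x` to the rank one operator `z ↦ ⟪e,
z⟫ x`, cut down by `P`, is injective on the range, as evaluation at `e` shows. -/
theorem finrank_range_le_of_corner_le [FiniteDimensional ℂ L] {P : L →L[ℂ] L}
    (hP : IsStarProjection P) {S : Submodule ℂ (L →L[ℂ] L)} (h : ∀ T, P * T * P ∈ S) :
    Module.finrank ℂ P.range ≤ Module.finrank ℂ S := by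
  by_cases h0 : P.range = ⊥
  · rw [h0, finrank_bot]; exact Nat.zero_le _
  obtain ⟨e, he, he0⟩ := Submodule.exists_mem_ne_zero_of_ne_bot h0
  have hPx : ∀ x ∈ P.range, P x = x := by
    rintro _ ⟨x, rfl⟩
    exact congrArg (fun T : L →L[ℂ] L => T x) hP.1.eq
  let g : P.range →ₗ[ℂ] S :=
    { toFun := fun x => ⟨P * (innerSL ℂ e).smulRight (x : L) * P, h _⟩
      map_add' := fun x y => by
        ext z; simp
      map_smul' := fun c x => by
        ext z
        change P (⟪e, P z⟫_ℂ • c • (x : L)) = c • P (⟪e, P z⟫_ℂ • (x : L))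
        rw [smul_comm, map_smul] }
  refine LinearMap.finrank_le_finrank_of_injective (f := g) fun x y hxy => ?_
  have h1 := congrArg (fun T : S => (T : L →L[ℂ] L) e) hxy
  change P (⟪e, P e⟫_ℂ • (x : L)) = P (⟪e, P e⟫_ℂ • (y : L)) at h1
  rw [hPx e he, map_smul, map_smul, hPx _ x.2, hPx _ y.2] at h1
  exact Subtype.ext (smul_right_injective L (inner_self_ne_zero.2 he0) h1)

/-- In a reflexive quantum metric on `M_n`, a projection of small diameter has its whole corner
in the operators of small displacement. -/
theorem QuantumMetric.IsReflexive.corner_mem {n : ℕ} {𝓦 : QuantumMetric (fullAlgebra n)}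
    (h𝓦 : 𝓦.IsReflexive) {P : EuclideanSpace ℂ (Fin n) →L[ℂ] EuclideanSpace ℂ (Fin n)}
    {D t : ℝ≥0} (hDt : D < t)
    (hD : ∀ Q R, IsProj (fullAlgebra n) Q → IsProj (fullAlgebra n) R → Q * P ≠ 0 → P * R ≠ 0 →
      𝓦.dist Q R ≤ D) (T : EuclideanSpace ℂ (Fin n) →L[ℂ] EuclideanSpace ℂ (Fin n)) :
    P * T * P ∈ 𝓦.V t := by
  rw [← SetLike.mem_coe]
  rw [h𝓦 t]
  intro Q R hQ hR h
  by_cases hQP : Q * P = 0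
  · rw [← mul_assoc, ← mul_assoc, hQP, zero_mul, zero_mul, zero_mul]
  by_cases hPR : P * R = 0
  · rw [mul_assoc, mul_assoc, hPR, mul_zero, mul_zero]
  exfalso
  -- If `V t` did not link `Q` to `R`, their distance would be at least `t > D`, although both meet
  -- `P`.
  refine absurd ((le_dist fun s hs A hA => ?_).trans
    (hD Q R ⟨hQ, trivial⟩ ⟨hR, trivial⟩ hQP hPR)) (not_le.2 (ENNReal.coe_lt_coe.2 hDt))
  exact h A (𝓦.V_mono (ENNReal.coe_lt_coe.1 hs).le hA)

/-- The second factor bounds the rank of `P` by the dimension of `V (D + 1)`, where `D + 1` is just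
some number above `D`; the first is the growth caused by `V k`. -/
theorem KrausRep.finrank_act_le_of_dist_le {n d : ℕ} {ε : ℝ}
    {Φ : Matrix (Fin n) (Fin n) ℂ →ₗ[ℂ] Matrix (Fin n) (Fin n) ℂ} (C : KrausRep Φ)
    (hΦ : IsQuantumExpander d ε Φ) (hC : C.quantumMetric.IsReflexive)
    {P : EuclideanSpace ℂ (Fin n) →L[ℂ] EuclideanSpace ℂ (Fin n)} (hP : IsStarProjection P)
    {D : ℝ≥0} (k : ℕ)
    (hD : ∀ Q R, IsProj (fullAlgebra n) Q → IsProj (fullAlgebra n) R → Q * P ≠ 0 → P * R ≠ 0 →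
      C.quantumMetric.dist Q R ≤ D) :
    Module.finrank ℂ (act (C.quantumMetric.V k) P.range) ≤
      (d * d) ^ k * (d * d) ^ ⌊D + 1⌋₊ := by
  have hV : ∀ t, Module.finrank ℂ (C.quantumMetric.V t) ≤ (d * d) ^ ⌊t⌋₊ := fun t =>
    (finrank_pow_le _ _).trans (Nat.pow_le_pow_left (C.finrank_system_le hΦ) _)
  refine (finrank_act_le _ _).trans (Nat.mul_le_mul ?_ ?_)
  · simpa using hV k
  · exact (finrank_range_le_of_corner_le hP
      (hC.corner_mem (lt_add_of_pos_right D one_pos) hD)).trans (hV _)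

end Reflexive

/-! ### Balls in expander graphs -/

section GraphBall

variable {X : Type*} [Fintype X] [DecidableEq X]

open Classical in
/-- The `k`-neighbourhood of a set of vertices. -/
noncomputable def graphBall (G : SimpleGraph X) (k : ℕ) (A : Finset X) : Finset X :=
  {y | ∃ x ∈ A, G.edist y x ≤ k}

variable {G : SimpleGraph X}

theorem mem_graphBall {k : ℕ} {A : Finset X} {y : X} :
    y ∈ graphBall G k A ↔ ∃ x ∈ A, G.edist y x ≤ k := by
  simp [graphBall]

theorem subset_graphBall (k : ℕ) (A : Finset X) : A ⊆ graphBall G k A := fun x hx =>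
  mem_graphBall.2 ⟨x, hx, by simp⟩

theorem mem_graphBall_one {A : Finset X} {y : X} :
    y ∈ graphBall G 1 A ↔ y ∈ A ∨ ∃ x ∈ A, G.Adj x y := by
  rw [mem_graphBall]
  simp only [Nat.cast_one, SimpleGraph.edist_le_one_iff_adj_or_eq]
  constructor
  · rintro ⟨x, hx, h | rfl⟩
    · exact Or.inr ⟨x, hx, h.symm⟩
    · exact Or.inl hx
  · rintro (h | ⟨x, hx, h⟩)
    · exact ⟨y, h, Or.inr rfl⟩
    · exact ⟨x, hx, Or.inl h.symm⟩

theorem graphBall_succ (k : ℕ) (A : Finset X) :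
    graphBall G (k + 1) A = graphBall G 1 (graphBall G k A) := by
  ext y
  constructor
  · intro h
    obtain ⟨x, hx, hxy⟩ := mem_graphBall.1 h
    -- The first edge of a shortest walk from `y` to `x` is peeled off.
    obtain ⟨p, hp⟩ := SimpleGraph.exists_walk_of_edist_ne_top
      (ne_top_of_le_ne_top (ENat.natCast_ne_top _) hxy)
    rw [← hp] at hxy
    cases p with
    | nil => exact subset_graphBall _ _ (subset_graphBall _ _ hx)
    | cons hadj q =>
      rw [SimpleGraph.Walk.length_cons] at hxy
      refine mem_graphBall_one.2 (Or.inr ⟨_, mem_graphBall.2 ⟨x, hx, ?_⟩, hadj.symm⟩)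
      refine (SimpleGraph.edist_le q).trans ?_
      have : q.length + 1 ≤ k + 1 := by exact_mod_cast hxy
      exact_mod_cast Nat.le_of_succ_le_succ this
  · intro h
    obtain ⟨z, hz, hyz⟩ := mem_graphBall.1 h
    obtain ⟨x, hx, hzx⟩ := mem_graphBall.1 hz
    refine mem_graphBall.2 ⟨x, hx, SimpleGraph.edist_triangle.trans ((add_le_add hyz hzx).trans ?_)⟩
    push_cast
    rw [add_comm]

theorem card_graphBall_le {d : ℕ} (hd : ∀ x, (G.neighborSet x).ncard = d) (k : ℕ)
    (A : Finset X) : (graphBall G k A).card ≤ (d + 1) ^ k * A.card := by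
  classical
  have hone : ∀ B : Finset X, (graphBall G 1 B).card ≤ (d + 1) * B.card := fun B => by
    have hsub : graphBall G 1 B ⊆ B.biUnion fun x => insert x (G.neighborSet x).toFinset := by
      intro y hy
      rw [Finset.mem_biUnion]
      rcases mem_graphBall_one.1 hy with h | ⟨x, hx, h⟩
      · exact ⟨y, h, Finset.mem_insert_self _ _⟩
      · exact ⟨x, hx, Finset.mem_insert_of_mem (by simpa using h)⟩
    refine (Finset.card_le_card hsub).trans ?_
    rw [mul_comm]
    refine Finset.card_biUnion_le_card_mul _ _ _ fun x _ => (Finset.card_insert_le _ _).trans ?_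
    rw [← Set.ncard_eq_toFinset_card', hd]
  induction k with
  | zero =>
    rw [pow_zero, one_mul]
    refine Finset.card_le_card fun y hy => ?_
    obtain ⟨x, hx, h⟩ := mem_graphBall.1 hy
    rw [Nat.cast_zero, nonpos_iff_eq_zero, SimpleGraph.edist_eq_zero_iff] at h
    exact h ▸ hx
  | succ k ih =>
    rw [graphBall_succ, pow_succ', mul_assoc]
    exact (hone _).trans (Nat.mul_le_mul_left _ ih)

/-- Each vertex outside `A` receives at most `d` boundary edges, so edge expansion gives vertex
expansion. Dividing by `d + 1` instead of `d` avoids the case `d = 0`. -/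
theorem IsClassicalExpander.mul_card_le {d : ℕ} {ε : ℝ} (hG : IsClassicalExpander d ε G)
    {A : Finset X} (hA : 2 * A.card ≤ Fintype.card X) :
    (1 + ε / (d + 1)) * (A.card : ℝ) ≤ (graphBall G 1 A).card := by
  classical
  obtain ⟨hd, hexp⟩ := hG
  have h1 := hexp A hA
  have hcount : ({p : X × X | p.1 ∈ A ∧ p.2 ∉ A ∧ G.Adj p.1 p.2}.toFinset).card ≤
      d * (graphBall G 1 A \ A).card := by
    refine Finset.card_le_mul_card_image_of_maps_to (f := Prod.snd) ?_ d ?_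
    · intro p hp
      rw [Set.mem_toFinset] at hp
      exact Finset.mem_sdiff.2 ⟨mem_graphBall_one.2 (Or.inr ⟨p.1, hp.1, hp.2.2⟩), hp.2.1⟩
    · intro y _
      rw [← hd y, Set.ncard_eq_toFinset_card']
      refine Finset.card_le_card_of_injOn Prod.fst ?_ ?_
      · intro p hp
        simp only [Finset.coe_filter, Set.mem_toFinset, Set.mem_ofPred_eq] at hp
        rw [Set.coe_toFinset, SimpleGraph.mem_neighborSet, ← hp.2]
        exact hp.1.2.2.symm
      · intro p hp q hq hpq
        simp only [Finset.coe_filter, Set.mem_ofPred_eq] at hp hq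
        exact Prod.ext hpq (hp.2.trans hq.2.symm)
  rw [Set.ncard_eq_toFinset_card'] at h1
  have h2 : ε * (A.card : ℝ) ≤ d * ((graphBall G 1 A \ A).card : ℝ) :=
    h1.trans (by exact_mod_cast hcount)
  have h3 : ((graphBall G 1 A \ A).card : ℝ) + A.card = (graphBall G 1 A).card := by
    exact_mod_cast Finset.card_sdiff_add_card_eq_card (subset_graphBall (G := G) 1 A)
  have h4 : ε / (d + 1) * (A.card : ℝ) ≤ (graphBall G 1 A \ A).card := by
    rw [div_mul_eq_mul_div, div_le_iff₀ (by positivity)]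
    have : (0 : ℝ) ≤ (graphBall G 1 A \ A).card := Nat.cast_nonneg _
    linarith
  linarith

theorem IsClassicalExpander.pow_mul_card_le {d : ℕ} {ε : ℝ} (hε : 0 < ε)
    (hG : IsClassicalExpander d ε G) (k : ℕ) {A : Finset X}
    (hA : 2 * (graphBall G k A).card ≤ Fintype.card X) :
    (1 + ε / (d + 1)) ^ k * (A.card : ℝ) ≤ (graphBall G k A).card := by
  induction k with
  | zero =>
    rw [pow_zero, one_mul]
    exact_mod_cast Finset.card_le_card (subset_graphBall (G := G) 0 A)
  | succ k ih =>
    rw [graphBall_succ] at hA ⊢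
    have hle := Finset.card_le_card (subset_graphBall (G := G) 1 (graphBall G k A))
    have h1 := ih (by omega)
    calc (1 + ε / (d + 1)) ^ (k + 1) * (A.card : ℝ)
        = (1 + ε / (d + 1)) * ((1 + ε / (d + 1)) ^ k * A.card) := by ring
      _ ≤ (1 + ε / (d + 1)) * ((graphBall G k A).card : ℝ) := by gcongr
      _ ≤ _ := hG.mul_card_le (by omega)

end GraphBall

/-! ### Coordinate subspaces and diagonal projections -/

section Coordinate

variable {X : Type*} [Fintype X] [DecidableEq X]

/-- The subspace of the vectors supported in a set of coordinates. -/
def coordSpace (A : Finset X) : Submodule ℂ (EuclideanSpace ℂ X) where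
  carrier := {v | ∀ x ∉ A, v x = 0}
  add_mem' hv hw x hx := by simp [hv x hx, hw x hx]
  zero_mem' x _ := rfl
  smul_mem' c v hv x hx := by simp [hv x hx]

theorem mem_coordSpace {A : Finset X} {v : EuclideanSpace ℂ X} :
    v ∈ coordSpace A ↔ ∀ x ∉ A, v x = 0 := Iff.rfl

theorem coordSpace_eq_span (A : Finset X) :
    coordSpace A = Submodule.span ℂ
      (Set.range fun x : A => (EuclideanSpace.single x.1 1 : EuclideanSpace ℂ X)) := by
  apply le_antisymm
  · intro v hv
    have hsum : v = ∑ x : A, v x.1 • (EuclideanSpace.single x.1 1 : EuclideanSpace ℂ X) := by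
      ext y
      rw [Finset.sum_coe_sort A fun x => v x • (EuclideanSpace.single x 1 : EuclideanSpace ℂ X)]
      by_cases hy : y ∈ A
      · simp [hy, Pi.single_apply]
      · simp [hy, Pi.single_apply, hv y hy]
    rw [hsum]
    exact sum_mem fun x _ => Submodule.smul_mem _ _ (Submodule.subset_span ⟨x, rfl⟩)
  · refine Submodule.span_le.2 ?_
    rintro _ ⟨x, rfl⟩ y hy
    have : y ≠ x.1 := fun h => hy (h ▸ x.2)
    simp [this]

theorem finrank_coordSpace (A : Finset X) : Module.finrank ℂ (coordSpace A) = A.card := by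
  rw [coordSpace_eq_span, finrank_span_eq_card, Fintype.card_coe]
  exact (EuclideanSpace.orthonormal_single (𝕜 := ℂ) (ι := X)).linearIndependent.comp _
    Subtype.val_injective

theorem matOp_apply (B : Matrix X X ℂ) (v : EuclideanSpace ℂ X) (x : X) :
    matOp B v x = ∑ y, B x y * v y := rfl

theorem range_matOp_diagonal (f : X → ℂ) :
    (matOp (Matrix.diagonal f)).range = coordSpace {x | f x ≠ 0} := by
  have happ : ∀ v x, matOp (Matrix.diagonal f) v x = f x * v x := fun v x =>
    Matrix.mulVec_diagonal _ _ _
  ext v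
  constructor
  · rintro ⟨w, rfl⟩ x hx
    have : f x = 0 := by simpa using hx
    exact (happ w x).trans (by rw [this, zero_mul])
  · intro hv
    refine ⟨WithLp.toLp 2 fun x => (f x)⁻¹ * v x, ?_⟩
    ext x
    refine (happ _ x).trans ?_
    by_cases hx : f x = 0
    · rw [hx, zero_mul, mem_coordSpace.1 hv x (by simpa using hx)]
    · exact mul_inv_cancel_left₀ hx _

theorem isProj_matOp_single (x : X) :
    IsProj (diagonalAlgebra X) (matOp (Matrix.diagonal (Pi.single x 1))) := by
  refine ⟨⟨?_, ?_⟩, ⟨_, rfl⟩⟩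
  · rw [IsIdempotentElem, ← map_mul, Matrix.diagonal_mul_diagonal]
    congr 2
    ext y
    simp [Pi.single_apply]
  · rw [IsSelfAdjoint, ← map_star, Matrix.star_eq_conjTranspose, Matrix.diagonal_conjTranspose]
    congr 2
    ext y
    simp [Pi.single_apply, apply_ite]

end Coordinate

/-! ### Expansion and bounded rank for graph metrics -/

section GraphMetric

variable {X : Type*} [Fintype X] [DecidableEq X] {G : SimpleGraph X}

theorem mem_graphQuantumMetric {t : ℝ≥0} {A} : A ∈ (graphQuantumMetric G).V t ↔
    ∀ x y, (t : ℝ≥0∞) < (G.edist x y : ℝ≥0∞) → matOp.symm A x y = 0 := Iff.rfl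

/-- Entries linking vertices further apart than `k` vanish, and conversely the matrix units between
vertices at distance at most `k` reach every basis vector of the ball. -/
theorem act_graphQuantumMetric (k : ℕ) (A : Finset X) :
    act ((graphQuantumMetric G).V k) (coordSpace A) = coordSpace (graphBall G k A) := by
  have hcast : ∀ x y, (((k : ℝ≥0) : ℝ≥0∞) < (G.edist x y : ℝ≥0∞)) ↔ ¬ G.edist x y ≤ k :=
    fun x y => by
      rw [ENNReal.coe_natCast, ← ENat.toENNReal_coe, ENat.toENNReal_lt, not_le]
  apply le_antisymm
  · refine act_le.2 fun T hT v hv y hy => ?_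
    obtain ⟨B, rfl⟩ : ∃ B, matOp (ι := X) B = T :=
      ⟨matOp.symm T, StarAlgEquiv.apply_symm_apply _ _⟩
    rw [matOp_apply]
    refine Finset.sum_eq_zero fun x _ => ?_
    by_cases hx : x ∈ A
    · have := mem_graphQuantumMetric.1 hT y x
        ((hcast _ _).2 fun h => hy (mem_graphBall.2 ⟨x, hx, h⟩))
      rw [StarAlgEquiv.symm_apply_apply] at this
      rw [this, zero_mul]
    · rw [hv x hx, mul_zero]
  · rw [coordSpace_eq_span, Submodule.span_le]
    rintro _ ⟨⟨y, hy⟩, rfl⟩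
    obtain ⟨x, hx, hxy⟩ := mem_graphBall.1 hy
    have hT : matOp (Matrix.single y x (1 : ℂ)) ∈ (graphQuantumMetric G).V k := by
      rw [mem_graphQuantumMetric]
      intro a b hab
      rw [StarAlgEquiv.symm_apply_apply]
      refine Matrix.single_apply_of_ne _ _ _ _ _ ?_
      rintro ⟨rfl, rfl⟩
      exact (hcast _ _).1 hab hxy
    have hx' : (EuclideanSpace.single x 1 : EuclideanSpace ℂ X) ∈ coordSpace A := by
      rw [coordSpace_eq_span]
      exact Submodule.subset_span ⟨⟨x, hx⟩, rfl⟩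
    have heq : matOp (Matrix.single y x (1 : ℂ)) (EuclideanSpace.single x 1) =
        EuclideanSpace.single y 1 := by
      ext z
      rw [matOp_apply]
      simp [Matrix.single_apply, eq_comm]
    have := apply_mem_act hT hx'
    rwa [heq] at this

theorem IsProj.exists_range_eq_coordSpace {P : EuclideanSpace ℂ X →L[ℂ] EuclideanSpace ℂ X}
    (hP : IsProj (diagonalAlgebra X) P) : ∃ A : Finset X, P.range = coordSpace A := by
  obtain ⟨f, rfl⟩ := hP.2
  exact ⟨_, range_matOp_diagonal f⟩

theorem IsClassicalExpander.pow_mul_finrank_le {d : ℕ} {ε : ℝ} (hε : 0 < ε)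
    (hG : IsClassicalExpander d ε G) (k : ℕ) {P : EuclideanSpace ℂ X →L[ℂ] EuclideanSpace ℂ X}
    (hP : IsProj (diagonalAlgebra X) P)
    (h : 2 * Module.finrank ℂ (act ((graphQuantumMetric G).V k) P.range) ≤ Fintype.card X) :
    (1 + ε / (d + 1)) ^ k * (Module.finrank ℂ P.range : ℝ) ≤
      Module.finrank ℂ (act ((graphQuantumMetric G).V k) P.range) := by
  obtain ⟨A, hA⟩ := hP.exists_range_eq_coordSpace
  rw [hA, act_graphQuantumMetric, finrank_coordSpace] at h ⊢
  rw [finrank_coordSpace]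
  exact hG.pow_mul_card_le hε k h

/-- Two vertices further apart than `⌈D⌉₊ + 1` give coordinate projections at distance at least `D +
1`; the added `1` is slack making the contradiction strict. -/
theorem edist_le_of_dist_le {x y : X} {D : ℝ≥0} (h : (graphQuantumMetric G).dist
      (matOp (Matrix.diagonal (Pi.single x 1))) (matOp (Matrix.diagonal (Pi.single y 1))) ≤ D) :
    G.edist x y ≤ (⌈D⌉₊ + 1 : ℕ) := by
  by_contra! hlt
  have hlt' : ((D + 1 : ℝ≥0) : ℝ≥0∞) < (G.edist x y : ℝ≥0∞) := by
    refine lt_of_le_of_lt ?_ (ENat.toENNReal_lt.2 hlt)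
    rw [ENat.toENNReal_coe, ← ENNReal.coe_natCast, ENNReal.coe_le_coe]
    push_cast
    gcongr
    exact Nat.le_ceil D
  refine absurd ((QuantumMetric.le_dist (r := ((D + 1 : ℝ≥0) : ℝ≥0∞)) fun t ht A hA => ?_).trans h)
    (not_le.2 (ENNReal.coe_lt_coe.2 (lt_add_of_pos_right D one_pos)))
  obtain ⟨B, rfl⟩ : ∃ B, matOp (ι := X) B = A :=
    ⟨matOp.symm A, StarAlgEquiv.apply_symm_apply _ _⟩
  have hB := mem_graphQuantumMetric.1 hA x y (ht.trans hlt')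
  rw [StarAlgEquiv.symm_apply_apply] at hB
  rw [← map_mul, ← map_mul, ← map_zero (matOp (ι := X))]
  congr 1
  ext a b
  rw [Matrix.mul_diagonal, Matrix.diagonal_mul, Matrix.zero_apply]
  by_cases ha : a = x
  · by_cases hb : b = y
    · rw [ha, hb, hB, mul_zero, zero_mul]
    · rw [Pi.single_eq_of_ne hb, mul_zero]
  · rw [Pi.single_eq_of_ne ha, zero_mul, zero_mul]

/-- The support of `P` lies in a ball of radius `⌈D⌉₊ + 1` about any of its points, tested by
coordinate projections; degree bounds do the rest. -/
theorem IsClassicalExpander.finrank_act_le_of_dist_le {d : ℕ} {ε : ℝ}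
    (hG : IsClassicalExpander d ε G) {P : EuclideanSpace ℂ X →L[ℂ] EuclideanSpace ℂ X}
    (hP : IsProj (diagonalAlgebra X) P) {D : ℝ≥0} (k : ℕ)
    (hD : ∀ Q R, IsProj (diagonalAlgebra X) Q → IsProj (diagonalAlgebra X) R → Q * P ≠ 0 →
      P * R ≠ 0 → (graphQuantumMetric G).dist Q R ≤ D) :
    Module.finrank ℂ (act ((graphQuantumMetric G).V k) P.range) ≤
      (d + 1) ^ k * (d + 1) ^ (⌈D⌉₊ + 1) := by
  obtain ⟨f, rfl⟩ := hP.2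
  rw [range_matOp_diagonal, act_graphQuantumMetric, finrank_coordSpace]
  refine (card_graphBall_le hG.1 k _).trans (Nat.mul_le_mul_left _ ?_)
  set A : Finset X := {x | f x ≠ 0} with hA
  rcases A.eq_empty_or_nonempty with h0 | ⟨x, hx⟩
  · rw [h0, Finset.card_empty]; exact Nat.zero_le _
  have hne : ∀ z ∈ A, matOp (Matrix.diagonal (Pi.single z 1)) * matOp (Matrix.diagonal f) ≠ 0 ∧
      matOp (Matrix.diagonal f) * matOp (Matrix.diagonal (Pi.single z 1)) ≠ 0 := fun z hz => by
    have hz' : f z ≠ 0 := by simpa [hA] using hz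
    rw [← map_mul, ← map_mul, Matrix.diagonal_mul_diagonal, Matrix.diagonal_mul_diagonal]
    constructor
    · intro h
      have h1 := (map_eq_zero_iff _ (matOp (ι := X)).injective).1 h
      have h2 := congrFun (congrFun h1 z) z
      exact hz' (by simpa using h2)
    · intro h
      have h1 := (map_eq_zero_iff _ (matOp (ι := X)).injective).1 h
      have h2 := congrFun (congrFun h1 z) z
      exact hz' (by simpa using h2)
  have hsub : A ⊆ graphBall G (⌈D⌉₊ + 1) {x} := fun y hy =>
    mem_graphBall.2 ⟨x, Finset.mem_singleton_self _, edist_le_of_dist_le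
      (hD _ _ (isProj_matOp_single y) (isProj_matOp_single x) (hne y hy).1 (hne x hx).2)⟩
  refine (Finset.card_le_card hsub).trans ((card_graphBall_le hG.1 _ _).trans_eq ?_)
  rw [Finset.card_singleton, mul_one]

end GraphMetric

/-! ### Compression by a central projection -/

section Compression

variable {H : Type*} [NormedAddCommGroup H] [InnerProductSpace ℂ H] [CompleteSpace H]
  {E : Submodule ℂ H} [CompleteSpace E]

theorem continuous_compress : @Continuous _ _ (weakStar H) (weakStar E) (compress E) := by
  letI := weakStar H
  refine continuous_weakStar_rng _ fun x y => ?_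
  have h := continuous_weakStar_inner_ampl (H := H)
    (lp.mapCLM 2 (fun _ : ℕ => E.subtypeL) (norm_nonneg _) (fun _ => le_rfl) x)
    (lp.mapCLM 2 (fun _ : ℕ => E.subtypeL) (norm_nonneg _) (fun _ => le_rfl) y)
  convert h using 2 with A
  rw [lp.inner_eq_tsum, lp.inner_eq_tsum]
  refine tsum_congr fun i => ?_
  change ⟪x i, E.orthogonalProjectionOnto (A (y i))⟫_ℂ = ⟪(x i : H), A (y i)⟫_ℂ
  rw [← Submodule.inner_orthogonalProjectionOnto_eq_of_mem_left]

theorem starProjection_mul_self : E.starProjection * E.starProjection = E.starProjection :=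
  Submodule.isIdempotentElem_starProjection E

theorem starProjection_commute {M : VonNeumannAlgebra H} (hE' : E.starProjection ∈ M.commutant)
    {A : H →L[ℂ] H} (hA : A ∈ M) : E.starProjection * A = A * E.starProjection :=
  (VonNeumannAlgebra.mem_commutant_iff.1 hE' A hA).symm

theorem extend_compress_of_mem {M : VonNeumannAlgebra H} (hE' : E.starProjection ∈ M.commutant)
    {A : H →L[ℂ] H} (hA : A ∈ M) : extend E (compress E A) = A * E.starProjection := by
  rw [extend_compress, starProjection_commute hE' hA, mul_assoc, starProjection_mul_self]

/-- The canonical quantum function from `M` onto its reduction `R M` by a central projection. -/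
noncomputable def compressFunction (M : VonNeumannAlgebra H) (hE : E.starProjection ∈ M)
    (hE' : E.starProjection ∈ M.commutant) : QuantumFunction M (reducedAlgebra M hE hE') where
  toHom :=
    { toFun := fun A => ⟨compress E A, mem_reducedAlgebra.2 (by
        rw [extend_compress]; exact mul_mem' (mul_mem' hE A.2) hE)⟩
      map_one' := Subtype.ext (extend_injective (by
        change extend E (compress E 1) = extend E 1
        rw [extend_compress, extend_one, mul_one, starProjection_mul_self]))
      map_mul' := fun A B => Subtype.ext (extend_injective (by
        change extend E (compress E ((A : H →L[ℂ] H) * B)) =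
          extend E (compress E (A : H →L[ℂ] H) * compress E (B : H →L[ℂ] H))
        rw [extend_mul, extend_compress_of_mem hE' (mul_mem' A.2 B.2),
          extend_compress_of_mem hE' A.2, extend_compress_of_mem hE' B.2, mul_assoc, mul_assoc,
          ← mul_assoc E.starProjection, starProjection_commute hE' B.2, mul_assoc,
          starProjection_mul_self]))
      map_zero' := Subtype.ext (by
        ext x
        change ((E.orthogonalProjectionOnto 0 : E) : H) = 0
        simp)
      map_add' := fun A B => Subtype.ext (by
        ext x
        exact congrArg Subtype.val (map_add E.orthogonalProjectionOnto
          ((A : H →L[ℂ] H) x) ((B : H →L[ℂ] H) x)))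
      commutes' := fun c => Subtype.ext (by
        ext x
        change ((E.orthogonalProjectionOnto (c • (x : H)) : E) : H) = c • (x : H)
        simp)
      map_star' := fun A => Subtype.ext (extend_injective (by
        change extend E (compress E (star (A : H →L[ℂ] H))) =
          extend E (star (compress E (A : H →L[ℂ] H)))
        rw [extend_star, extend_compress, extend_compress, star_mul, star_mul, mul_assoc,
          (isStarProjection_starProjection (U := E)).2.star_eq])) }
  weakStar_continuous := by
    refine (@continuous_induced_rng _ _ _ _ _ (weakStar E) (_)).2 ?_
    exact @Continuous.comp _ _ _ (TopologicalSpace.induced Subtype.val (weakStar H)) (weakStar H)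
      (weakStar E) _ _ continuous_compress continuous_induced_dom

end Compression

/-! ### Composition and isometric isomorphisms -/

section Composition

variable {H : Type*} [NormedAddCommGroup H] [InnerProductSpace ℂ H] [CompleteSpace H]
  {K : Type*} [NormedAddCommGroup K] [InnerProductSpace ℂ K] [CompleteSpace K]
  {L : Type*} [NormedAddCommGroup L] [InnerProductSpace ℂ L] [CompleteSpace L]
  {M : VonNeumannAlgebra H} {N : VonNeumannAlgebra K} {O : VonNeumannAlgebra L}

/-- The composition of two quantum functions. -/
noncomputable def QuantumFunction.comp (ψ : QuantumFunction N O) (φ : QuantumFunction M N) :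
    QuantumFunction M O where
  toHom := ψ.toHom.comp φ.toHom
  weakStar_continuous :=
    @Continuous.comp _ _ _ (TopologicalSpace.induced Subtype.val (weakStar H))
      (TopologicalSpace.induced Subtype.val (weakStar K))
      (TopologicalSpace.induced Subtype.val (weakStar L)) _ _
      ψ.weakStar_continuous φ.weakStar_continuous

theorem QuantumFunction.isProj_map (φ : QuantumFunction M N) {P : M.toStarSubalgebra}
    (hP : IsStarProjection (P : H →L[ℂ] H)) : IsProj N (φ.toHom P : K →L[ℂ] K) := by
  have hP' : IsStarProjection P := ⟨Subtype.ext hP.1, Subtype.ext hP.2⟩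
  exact ⟨(hP'.map φ.toHom).map N.toStarSubalgebra.subtype, (φ.toHom P).2⟩

/-- Isometric isomorphisms preserve the distance between projections of the algebra. -/
theorem QuantumFunction.IsIsometricIso.dist_map {φ : QuantumFunction M N} {𝓥 : QuantumMetric M}
    {𝓦 : QuantumMetric N} (hφ : φ.IsIsometricIso 𝓥 𝓦) {P Q : M.toStarSubalgebra}
    (hP : IsStarProjection (P : H →L[ℂ] H)) (hQ : IsStarProjection (Q : H →L[ℂ] H)) :
    𝓦.dist (φ.toHom P : K →L[ℂ] K) (φ.toHom Q : K →L[ℂ] K) = 𝓥.dist P Q := by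
  have hmaps : ∀ P : M.toStarSubalgebra,
      φ.StabMapsTo (ampl (P : H →L[ℂ] H)) (ampl (φ.toHom P : K →L[ℂ] K)) := fun P i j => by
    by_cases hij : i = j
    · refine ⟨by rw [entry_ampl, if_pos hij]; exact P.2, ?_⟩
      simp only [entry_ampl, if_pos hij]
    · refine ⟨by rw [entry_ampl, if_neg hij]; exact M.toStarSubalgebra.zero_mem, ?_⟩
      simp only [entry_ampl, if_neg hij]
      exact congrArg Subtype.val (map_zero φ.toHom)
  rw [← QuantumMetric.stabDist_ampl, ← QuantumMetric.stabDist_ampl]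
  exact hφ.2 _ _ _ _ (IsProj.ampl ⟨hP, P.2⟩) (IsProj.ampl ⟨hQ, Q.2⟩) (φ.isProj_map hP).ampl
    (φ.isProj_map hQ).ampl (hmaps P) (hmaps Q)

theorem QuantumFunction.IsIsometricIso.exists_map_eq {φ : QuantumFunction M N}
    {𝓥 : QuantumMetric M} {𝓦 : QuantumMetric N} (hφ : φ.IsIsometricIso 𝓥 𝓦) {Q : K →L[ℂ] K}
    (hQ : IsProj N Q) : ∃ P : M.toStarSubalgebra, IsStarProjection (P : H →L[ℂ] H) ∧
      (φ.toHom P : K →L[ℂ] K) = Q := by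
  obtain ⟨P, hP⟩ := hφ.1.2 ⟨Q, hQ.2⟩
  refine ⟨P, ⟨congrArg Subtype.val (hφ.1.1 ?_ : P * P = P),
    congrArg Subtype.val (hφ.1.1 ?_ : star P = P)⟩, congrArg Subtype.val hP⟩
  · rw [map_mul, hP]; exact Subtype.ext hQ.1.1
  · rw [map_star, hP]; exact Subtype.ext hQ.1.2

end Composition

/-! ### Distances in metric quotients -/

section QuotientDist

variable {H : Type*} [NormedAddCommGroup H] [InnerProductSpace ℂ H] [CompleteSpace H]
  {E : Submodule ℂ H} [CompleteSpace E] {M : VonNeumannAlgebra H} {𝓥 : QuantumMetric M}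
  {hE : E.starProjection ∈ M} {hE' : E.starProjection ∈ M.commutant}

theorem compress_mem_quotient {t : ℝ≥0} {A : H →L[ℂ] H} (hA : A ∈ 𝓥.V t) :
    compress E A ∈ (𝓥.quotient hE hE').V t := by
  rw [← SetLike.mem_coe, QuantumMetric.quotient_V]
  exact ⟨A, hA, rfl⟩

theorem extend_compress_mem {t : ℝ≥0} {A : H →L[ℂ] H} (hE : E.starProjection ∈ M)
    (hE' : E.starProjection ∈ M.commutant) (hA : A ∈ 𝓥.V t) :
    extend E (compress E A) ∈ 𝓥.V t :=
  compress_mem_quotient (hE := hE) (hE' := hE') hA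

theorem dist_extend_le_dist_quotient (P Q : E →L[ℂ] E) :
    𝓥.dist (extend E P) (extend E Q) ≤ (𝓥.quotient hE hE').dist P Q := by
  refine QuantumMetric.le_dist fun t ht A hA => extend_injective ?_
  rw [extend_mul, extend_mul, extend_zero]
  exact QuantumMetric.mul_mul_eq_zero_of_lt_dist ht hA

theorem dist_quotient_le_dist_extend (P Q : E →L[ℂ] E) :
    (𝓥.quotient hE hE').dist P Q ≤ 𝓥.dist (extend E P) (extend E Q) := by
  refine QuantumMetric.le_dist fun t ht A hA => ?_
  have h := congrArg (extend E)
    (QuantumMetric.mul_mul_eq_zero_of_lt_dist ht (compress_mem_quotient hA))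
  rw [extend_mul, extend_mul, extend_compress, extend_zero] at h
  calc extend E P * A * extend E Q
      = extend E P * E.starProjection * A * (E.starProjection * extend E Q) := by
        rw [extend_mul_starProjection, starProjection_mul_extend]
    _ = extend E P * (E.starProjection * A * E.starProjection) * extend E Q := by
        simp only [mul_assoc]
    _ = 0 := h

/-- With `R` the central projection, `P R A R Q` is `P (R A R) Q`, and `R A R` stays in `V t`
because `R` has displacement zero. -/
theorem dist_le_dist_compress {P Q : H →L[ℂ] H} (hP : P ∈ M) (hQ : Q ∈ M) :
    𝓥.dist P Q ≤ (𝓥.quotient hE hE').dist (compress E P) (compress E Q) := by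
  refine le_trans (QuantumMetric.le_dist fun t ht A hA => ?_) (dist_extend_le_dist_quotient _ _)
  have h := QuantumMetric.mul_mul_eq_zero_of_lt_dist ht (extend_compress_mem hE hE' hA)
  rw [extend_compress] at h
  rw [extend_compress_of_mem hE' hP, extend_compress_of_mem hE' hQ, ← starProjection_commute hE' hQ]
  calc P * E.starProjection * A * (E.starProjection * Q)
      = P * (E.starProjection * A * E.starProjection) * Q := by simp only [mul_assoc]
    _ = 0 := h

variable {K : Type*} [NormedAddCommGroup K] [InnerProductSpace ℂ K] [CompleteSpace K]
  {N : VonNeumannAlgebra K} {𝓦 : QuantumMetric N}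

/-- A metric quotient comes with a quantum function that does not decrease distances, and for which
any two projections meeting the image of `P` are at distance at most the diameter of `P`. -/
theorem IsMetricQuotient.exists_quantumFunction (h : IsMetricQuotient 𝓥 𝓦) :
    ∃ φ : QuantumFunction M N,
      (∀ P Q : M.toStarSubalgebra, IsStarProjection (P : H →L[ℂ] H) →
        IsStarProjection (Q : H →L[ℂ] H) →
        𝓥.dist P Q ≤ 𝓦.dist (φ.toHom P : K →L[ℂ] K) (φ.toHom Q : K →L[ℂ] K)) ∧
      ∀ P : M.toStarSubalgebra, ∀ Q R, IsProj N Q → IsProj N R →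
        Q * (φ.toHom P : K →L[ℂ] K) ≠ 0 → (φ.toHom P : K →L[ℂ] K) * R ≠ 0 →
        𝓦.dist Q R ≤ 𝓥.diam P := by
  obtain ⟨E, _, hE, hE', ψ, hψ⟩ := h
  refine ⟨ψ.comp (compressFunction M hE hE'), fun P Q hP hQ => ?_, fun P Q R hQ hR hQP hPR => ?_⟩
  · refine (dist_le_dist_compress (hE := hE) (hE' := hE') P.2 Q.2).trans_eq ?_
    exact (hψ.dist_map ((compressFunction M hE hE').isProj_map hP).1
      ((compressFunction M hE hE').isProj_map hQ).1).symm
  · obtain ⟨q, hq, rfl⟩ := hψ.exists_map_eq hQ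
    obtain ⟨r, hr, rfl⟩ := hψ.exists_map_eq hR
    have hproj : ∀ p : (reducedAlgebra M hE hE').toStarSubalgebra,
        IsStarProjection (p : E →L[ℂ] E) → IsProj M (extend E (p : E →L[ℂ] E)) := fun p hp => by
      refine ⟨⟨?_, ?_⟩, p.2⟩
      · rw [IsIdempotentElem, ← extend_mul, hp.1.eq]
      · rw [IsSelfAdjoint, ← extend_star, hp.2.star_eq]
    rw [hψ.dist_map hq hr]
    refine (dist_quotient_le_dist_extend _ _).trans
      (QuantumMetric.dist_le_diam (hproj q hq) (hproj r hr) (fun h0 => hQP ?_) fun h0 => hPR ?_)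
    · have h1 : q * (compressFunction M hE hE').toHom P = 0 := Subtype.ext (extend_injective (by
        change extend E ((q : E →L[ℂ] E) * compress E (P : H →L[ℂ] H)) = extend E 0
        rw [extend_mul, extend_compress_of_mem hE' P.2, ← mul_assoc, h0, zero_mul, extend_zero]))
      have h2 := congrArg ψ.toHom h1
      rw [map_mul, map_zero] at h2
      exact congrArg Subtype.val h2
    · have h1 : (compressFunction M hE hE').toHom P * r = 0 := Subtype.ext (extend_injective (by
        change extend E (compress E (P : H →L[ℂ] H) * (r : E →L[ℂ] E)) = extend E 0
        rw [extend_mul, extend_compress_of_mem hE' P.2, mul_assoc, starProjection_mul_extend, h0,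
          extend_zero]))
      have h2 := congrArg ψ.toHom h1
      rw [map_mul, map_zero] at h2
      exact congrArg Subtype.val h2

end QuotientDist

/-! ### The three cases -/

section Main

variable {H : Type*} [NormedAddCommGroup H] [InnerProductSpace ℂ H] [CompleteSpace H]
  {M : VonNeumannAlgebra H} {𝓥 : QuantumMetric M}

/-- The consequences of equi-coarse containment used to obstruct finite asymptotic dimension. -/
theorem EquiCoarselyContains.exists_quantumFunction {ι : Type*} {L : ι → Type*}
    [∀ i, NormedAddCommGroup (L i)] [∀ i, InnerProductSpace ℂ (L i)] [∀ i, CompleteSpace (L i)]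
    {N : ∀ i, VonNeumannAlgebra (L i)} {𝓦 : ∀ i, QuantumMetric (N i)}
    (h : EquiCoarselyContains 𝓥 𝓦) :
    ∃ (φ : ∀ i, QuantumFunction M (N i)) (f : ℝ≥0 → ℝ≥0∞) (g : ℝ≥0 → ℝ≥0),
      Tendsto f atTop (𝓝 ∞) ∧
      (∀ i (P Q : M.toStarSubalgebra), IsStarProjection (P : H →L[ℂ] H) →
        IsStarProjection (Q : H →L[ℂ] H) → ∀ r : ℝ≥0, (r : ℝ≥0∞) ≤ 𝓥.dist P Q →
        f r ≤ (𝓦 i).dist ((φ i).toHom P : L i →L[ℂ] L i) ((φ i).toHom Q : L i →L[ℂ] L i)) ∧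
      ∀ i (P : M.toStarSubalgebra), IsStarProjection (P : H →L[ℂ] H) →
        ∀ D : ℝ≥0, 𝓥.diam P ≤ D → ∀ Q R, IsProj (N i) Q → IsProj (N i) R →
        Q * ((φ i).toHom P : L i →L[ℂ] L i) ≠ 0 → ((φ i).toHom P : L i →L[ℂ] L i) * R ≠ 0 →
        (𝓦 i).dist Q R ≤ g D := by
  obtain ⟨φ, -, f, g, hf, hg, hfg⟩ := h
  refine ⟨φ, f, fun t => (g t).toNNReal, hf, fun i P Q hP hQ r hr => ?_,
    fun i P hP D hD Q R hQ hR hQP hPR => ?_⟩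
  · exact (hfg r i).1.trans ((iInf_le _ P).trans ((iInf_le _ Q).trans (iInf_le _ ⟨hP, hQ, hr⟩)))
  · rw [ENNReal.coe_toNNReal (hg D).ne]
    refine (QuantumMetric.dist_le_diam hQ hR hQP hPR).trans (le_trans ?_ (hfg D i).2)
    exact le_iSup_of_le P (le_iSup_of_le ⟨hP, hD⟩ le_rfl)

theorem asdim_eq_top_of_quantumExpander {d : ℕ} {ε : ℝ} (hε0 : 0 < ε) (hε : ε < 1) {n : ℕ → ℕ}
    {Φ : ∀ m, Matrix (Fin (n m)) (Fin (n m)) ℂ →ₗ[ℂ] Matrix (Fin (n m)) (Fin (n m)) ℂ}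
    (C : ∀ m, KrausRep (Φ m)) (hn : Tendsto n atTop atTop)
    (hΦ : ∀ m, IsQuantumExpander d ε (Φ m)) (hC : ∀ m, (C m).quantumMetric.IsReflexive)
    (φ : ∀ m, QuantumFunction M (fullAlgebra (n m))) {f : ℝ≥0 → ℝ≥0∞}
    (hf : Tendsto f atTop (𝓝 ∞)) (g : ℝ≥0 → ℝ≥0)
    (hdist : ∀ m (P Q : M.toStarSubalgebra), IsStarProjection (P : H →L[ℂ] H) →
      IsStarProjection (Q : H →L[ℂ] H) → ∀ r : ℝ≥0, (r : ℝ≥0∞) ≤ 𝓥.dist P Q →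
      f r ≤ (C m).quantumMetric.dist ((φ m).toHom P : _ →L[ℂ] _) ((φ m).toHom Q : _ →L[ℂ] _))
    (hdiam : ∀ m (P : M.toStarSubalgebra), IsStarProjection (P : H →L[ℂ] H) →
      ∀ D : ℝ≥0, 𝓥.diam P ≤ D → ∀ Q R, IsProj (fullAlgebra (n m)) Q →
      IsProj (fullAlgebra (n m)) R → Q * ((φ m).toHom P : _ →L[ℂ] _) ≠ 0 →
      ((φ m).toHom P : _ →L[ℂ] _) * R ≠ 0 → (C m).quantumMetric.dist Q R ≤ g D) :
    𝓥.asdim = ⊤ := by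
  have hκ0 : 0 < (1 - ε) ^ 4 := pow_pos (by linarith) 4
  have hκ1 : (1 - ε) ^ 4 < 1 := pow_lt_one₀ (by linarith) (by linarith) (by norm_num)
  refine QuantumMetric.asdim_eq_top_of_expansion φ hf hdist
    (c := (1 + (1 - ε) ^ 4) / (2 * (1 - ε) ^ 4)) (fun D k => ?_) ?_ (fun m k P _ hk => ?_) ?_
  · exact ⟨(d * d) ^ k * (d * d) ^ ⌊g D + 1⌋₊, fun m P hP hD =>
      (C m).finrank_act_le_of_dist_le (hΦ m) (hC m) ((φ m).isProj_map hP).1 k (hdiam m P hP D hD)⟩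
  · rw [one_lt_div (by positivity)]; linarith
  · rw [finrank_euclideanSpace_fin] at hk
    have hV : (C m).quantumMetric.V k = (C m).system ^ k :=
      congrArg ((C m).system ^ ·) (Nat.floor_natCast k)
    rw [hV] at hk ⊢
    exact (C m).pow_mul_finrank_le (hΦ m).1 hε0 hε _ k hk
  · simpa only [finrank_euclideanSpace_fin] using hn

theorem asdim_eq_top_of_classicalExpander {d : ℕ} {ε : ℝ} (hε : 0 < ε) {X : ℕ → Type*}
    [∀ m, Fintype (X m)] [∀ m, DecidableEq (X m)] {G : ∀ m, SimpleGraph (X m)}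
    (hX : Tendsto (fun m => Fintype.card (X m)) atTop atTop)
    (hG : ∀ m, IsClassicalExpander d ε (G m))
    (h : EquiCoarselyContains 𝓥 (fun m => graphQuantumMetric (G m))) : 𝓥.asdim = ⊤ := by
  obtain ⟨φ, f, g, hf, hdist, hdiam⟩ := h.exists_quantumFunction
  refine QuantumMetric.asdim_eq_top_of_expansion φ hf hdist
    (c := 1 + ε / (d + 1)) (fun D k => ?_) ?_ (fun m k P hP hk => ?_) ?_
  · exact ⟨(d + 1) ^ k * (d + 1) ^ (⌈g D⌉₊ + 1), fun m P hP hD =>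
      (hG m).finrank_act_le_of_dist_le ((φ m).isProj_map hP) k (hdiam m P hP D hD)⟩
  · have : 0 < ε / ((d : ℝ) + 1) := by positivity
    linarith
  · rw [finrank_euclideanSpace] at hk
    exact (hG m).pow_mul_finrank_le hε k hP hk
  · simpa only [finrank_euclideanSpace] using hX

end Main

end QuantumCoarse

/-- A quantum metric space that equi-coarsely contains a sequence of reflexive quantum expanders
has infinite asymptotic dimension; in particular this holds if it has such a sequence as metric
quotients, and if it equi-coarsely contains a sequence of classical expanders. -/
theorem mainTheorem1 {H : Type*} [NormedAddCommGroup H] [InnerProductSpace ℂ H] [CompleteSpace H]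
    (M : VonNeumannAlgebra H) (𝓥 : QuantumCoarse.QuantumMetric M) :
    (∀ (d : ℕ) (ε : ℝ), 0 < ε → ε < 1 →
      ∀ (n : ℕ → ℕ) (Φ : ∀ m, Matrix (Fin (n m)) (Fin (n m)) ℂ →ₗ[ℂ] Matrix (Fin (n m)) (Fin (n m)) ℂ)
        (C : ∀ m, QuantumCoarse.KrausRep (Φ m)),
        Tendsto n atTop atTop →
        (∀ m, QuantumCoarse.IsQuantumExpander d ε (Φ m)) →
        (∀ m, (C m).quantumMetric.IsReflexive) →
        (QuantumCoarse.EquiCoarselyContains 𝓥 (fun m => (C m).quantumMetric) → 𝓥.asdim = ⊤) ∧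
        ((∀ m, QuantumCoarse.IsMetricQuotient 𝓥 (C m).quantumMetric) → 𝓥.asdim = ⊤)) ∧
    (∀ (d : ℕ) (ε : ℝ), 0 < ε →
      ∀ (X : ℕ → Type*) [∀ m, Fintype (X m)] [∀ m, DecidableEq (X m)]
        (G : ∀ m, SimpleGraph (X m)),
        Tendsto (fun m => Fintype.card (X m)) atTop atTop →
        (∀ m, QuantumCoarse.IsClassicalExpander d ε (G m)) →
        QuantumCoarse.EquiCoarselyContains 𝓥
          (fun m => QuantumCoarse.graphQuantumMetric (G m)) →
        𝓥.asdim = ⊤) := by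
  refine ⟨fun d ε hε0 hε n Φ C hn hΦ hC => ⟨fun h => ?_, fun h => ?_⟩,
    fun d ε hε X _ _ G hX hG h =>
      QuantumCoarse.asdim_eq_top_of_classicalExpander hε hX hG h⟩
  · obtain ⟨φ, f, g, hf, hdist, hdiam⟩ := h.exists_quantumFunction
    exact QuantumCoarse.asdim_eq_top_of_quantumExpander hε0 hε C hn hΦ hC φ hf g hdist hdiam
  · choose φ hdist hdiam using fun m => (h m).exists_quantumFunction
    -- For metric quotients both control functions are the identity, so no coarse embedding
    -- estimates are involved.
    exact QuantumCoarse.asdim_eq_top_of_quantumExpander hε0 hε C hn hΦ hC φ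
      (ENNReal.tendsto_coe_nhds_top.2 tendsto_id) id
      (fun m P Q hP hQ r hr => hr.trans (hdist m P Q hP hQ))
      fun m P _ D hD Q R hQ hR hQP hPR => (hdiam m P Q R hQ hR hQP hPR).trans hD
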